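/- **Setting.** Let $T>0$, $x_0\in\mathbb R^n$, let $(\Omega,\rho)$ be a complete separable metric space with Borel $\sigma$-algebra $\mathcal B_\Omega$ and a Borel probability measure $\mu$, and let $f:[0,T]\times\mathbb R^n\times\mathbb R^m\times\Omega\to\mathbb R^n$, $g:\mathbb R^n\times\Omega\to\mathbb R$, $U:[0,T]\rightsquigarrow\mathbb R^m$. Write $\mathcal L$ for the Lebesgue measurable subsets of $[0,T]$, $\mathcal B^k$ for the Borel subsets of $\mathbb R^k$, and $\mathbb B$ for the closed unit ball. A *process* $(u,\{x(\cdot,\omega)\}_{\omega\in\Omega})$ consists of a Lebesgue measurable $u:[0,T]\to\mathbb R^m$ with $u(t)\in U(t)$ a.e. and arcs $x(\cdot,\omega)\in W^{1,1}([0,T],\mathbb R^n)$ such that, for every $\omega\in\Omega$, $x(0,\omega)=x_0$ and $\dot x(t,\omega)=f(t,x(t,\omega),u(t),\omega)$ for a.e. $t\in[0,T]$. There is no end-point constraint ($C(\omega)=\mathbb R^n$). The cost of a process is $\int_\Omega g(x(T,\omega);\omega)\,d\mu(\omega)$, understood as $+\infty$ if $\omega\mapsto g(x(T,\omega);\omega)$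 is not $\mu$-integrable. A process $(\bar u,\{\bar x(\cdot,\omega)\})$ of finite cost is a *$W^{1,1}$-local minimizer* if for some $\epsilon>0$ its cost is at most the cost of every process $(u,\{x(\cdot,\omega)\})$ with $|\bar x(0,\omega)-x(0,\omega)|+\|\dot{\bar x}(\cdot,\omega)-\dot x(\cdot,\omega)\|_{L^1(0,T)}\le\epsilon$ for all $\omega\in\operatorname{supp}(\mu)$. **Theorem.** Let $(\bar u,\{\bar x(\cdot,\omega)\})$ be a $W^{1,1}$-local minimizer, and suppose that for some $\delta>0$: 1. $f(\cdot,x,\cdot,\cdot)$ is $\mathcal L\times\mathcal B^m\times\mathcal B_\Omega$ measurable for each $x$; $U(t)\neq\emptyset$ for all $t$ and the graph of $U$ is $\mathcal L\times\mathcal B^m$ measurable; $f(t,x,U(t),\omega)$ is closed for all $(t,\omega)\in[0,T]\times\Omega$ and $x\in\bar x(t,\omega)+\delta\mathbb B$. 2. There are $c>0$ and an integrable $k_f:[0,T]\to\mathbb R$ such that for a.e. $t$, all $\omega\in\Omega$, $u\in U(t)$ and $x,x'\in\bar x(t,\omega)+\delta\mathbb B$: $|f(t,x,u,\omega)-f(t,x',u,\omega)|\le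 k_f(t)|x-x'|$ and $|f(t,x,u,\omega)|\le c$. 3. $g$ is $\mathcal B^n\times\mathcal B_\Omega$ measurable. 4. There is a nondecreasing $\theta_f:[0,\infty)\to[0,\infty)$ with $\lim_{s\downarrow0}\theta_f(s)=0$ such that for all $\omega,\omega_1,\omega_2\in\Omega$ $$\int_0^T\ \sup_{x\in\bar x(t,\omega)+\delta\mathbb B,\ u\in U(t)}|f(t,x,u,\omega_1)-f(t,x,u,\omega_2)|\,dt\le\theta_f(\rho(\omega_1,\omega_2)).$$ 5. $g(\cdot,\omega)$ is differentiable on $\bar x(T,\omega)+\delta\mathbb B$ for each $\omega\in\Omega$, and $(x,\omega)\mapsto\nabla_xg(x;\omega)$ is continuous on $\{(x,\omega):x\in\bar x(T,\omega)+\delta\mathbb B\}$. Moreover there is a $\mu$-integrable $k_g:\Omega\to\mathbb R$ with $|g(x;\omega)-g(x';\omega)|\le k_g(\omega)|x-x'|$ for all $\omega\in\operatorname{supp}(\mu)$ and $x,x'\in\bar x(T,\omega)+\delta\mathbb B$. 6. For a.e. $t$, $f(t,\cdot,u,\omega)$ is continuously differentiable on $\bar x(t,\omega)+\delta\mathbb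 B$ for all $u\in U(t)$, $\omega\in\Omega$; and $\omega\mapsto\nabla_xf(t,x,u,\omega)$ is continuous, uniformly with respect to $(t,x,u)$: for all $\omega_1\in\Omega$ and $\varepsilon>0$ there is $r>0$ such that $\rho(\omega_1,\omega_2)<r$ implies $|\nabla_xf(t,x,u,\omega_1)-\nabla_xf(t,x,u,\omega_2)|\le\varepsilon$ for a.e. $t$, all $u\in U(t)$ and all $x\in(\bar x(t,\omega_1)+\delta\mathbb B)\cap(\bar x(t,\omega_2)+\delta\mathbb B)$. Then there is an $\mathcal L\times\mathcal B_\Omega$ measurable $p:[0,T]\times\Omega\to\mathbb R^n$ such that * (i) $p(\cdot,\omega)\in W^{1,1}([0,T],\mathbb R^n)$ for all $\omega\in\operatorname{supp}(\mu)$; * (ii) for a.e. $t\in[0,T]$, the integrals below exist for all $u\in U(t)$ and $$\int_\Omega p(t,\omega)\cdot f(t,\bar x(t,\omega),\bar u(t),\omega)\,d\mu(\omega)=\max_{u\in U(t)}\int_\Omega p(t,\omega)\cdot f(t,\bar x(t,\omega),u,\omega)\,d\mu(\omega);$$ * (iii) $-\dot p(t,\omega)=[\nabla_xf(t,\bar x(t,\omega),\bar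 u(t),\omega)]^{T}p(t,\omega)$ for a.e. $t\in[0,T]$, for all $\omega\in\operatorname{supp}(\mu)$; * (iv) $-p(T,\omega)=\nabla_xg(\bar x(T,\omega);\omega)$ for all $\omega\in\operatorname{supp}(\mu)$. -/

import Mathlib

open MeasureTheory Set Filter Topology
open scoped NNReal ENNReal

/-- `ℝᵏ` with the Euclidean norm. -/
abbrev Euc (k : ℕ) : Type := EuclideanSpace ℝ (Fin k)

/-- The interval `[0,T]` equipped with the σ-algebra `ℒ` of its Lebesgue measurable subsets. -/
abbrev LebInterval (T : ℝ) : Type :=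
  NullMeasurableSpace (Icc (0 : ℝ) T) (Measure.comap Subtype.val (volume : Measure ℝ))

/-- The inclusion `[0,T] → ℝ`. -/
def LebInterval.val {T : ℝ} (t : LebInterval T) : ℝ :=
  Subtype.val (p := fun s => s ∈ Icc (0 : ℝ) T) t

/-- The data of the average cost control problem: horizon `T > 0`, initial state `x₀`, dynamics `f`,
terminal cost `g`, control sets `U(t)` and closed end-point sets `C(ω)`.  Functions of time are
written on `ℝ`; only their values on `[0,T]` are ever used. -/
structure AverageProblem (n m : ℕ) (Ω : Type*) where
  T : ℝ
  T_pos : 0 < T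
  x₀ : Euc n
  f : ℝ → Euc n → Euc m → Ω → Euc n
  g : Euc n → Ω → ℝ
  U : ℝ → Set (Euc m)
  C : Ω → Set (Euc n)
  isClosed_C : ∀ ω, IsClosed (C ω)

/-- `x ∈ W^{1,1}([0,T],ℝⁿ)`, i.e. `x` is absolutely continuous on `[0,T]`. -/
def IsW11 {n : ℕ} (T : ℝ) (x : ℝ → Euc n) : Prop :=
  AbsolutelyContinuousOnInterval x 0 T

/-- The norm `|x(0)| + ‖ẋ‖_{L¹(0,T)}` of `W^{1,1}([0,T],ℝⁿ)`. -/
noncomputable def normW11 {n : ℕ} (T : ℝ) (x : ℝ → Euc n) : ℝ :=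
  ‖x 0‖ + ∫ t in (0 : ℝ)..T, ‖deriv x t‖

/-- A modulus of continuity `θ : [0,∞) → [0,∞)`. -/
def IsModulus (θ : ℝ≥0 → ℝ≥0) : Prop :=
  Monotone θ ∧ Tendsto θ (𝓝[>] 0) (𝓝 0)

namespace AverageProblem

variable {n m : ℕ} {Ω : Type*}

/-- `u` is a control function: Lebesgue measurable with `u(t) ∈ U(t)` for a.e. `t ∈ [0,T]`. -/
def IsControl (P : AverageProblem n m Ω) (u : ℝ → Euc m) : Prop :=
  Measurable (fun t : LebInterval P.T => u t.val) ∧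
    ∀ᵐ t ∂(volume.restrict (Icc 0 P.T)), u t ∈ P.U t

/-- `(u, {x(·,ω)})` is a process. -/
def IsControlledPair (P : AverageProblem n m Ω) (u : ℝ → Euc m) (x : ℝ → Ω → Euc n) : Prop :=
  P.IsControl u ∧ ∀ ω, IsW11 P.T (fun t => x t ω) ∧ x 0 ω = P.x₀ ∧
    ∀ᵐ t ∂(volume.restrict (Icc 0 P.T)),
      HasDerivAt (fun s => x s ω) (P.f t (x t ω) (u t) ω) t

/-- The process is feasible: `∫ d_{C(ω)}(x(T,ω)) dμ(ω) = 0`. -/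
def IsFeasible [MeasurableSpace Ω] (P : AverageProblem n m Ω) (μ : Measure Ω)
    (u : ℝ → Euc m) (x : ℝ → Ω → Euc n) : Prop :=
  P.IsControlledPair u x ∧ ∫⁻ ω, Metric.infEDist (x P.T ω) (P.C ω) ∂μ = 0

open Classical in
/-- The averaged cost `∫ g(x(T,ω);ω) dμ(ω)`, with the value `+∞` if this integral does not exist. -/
noncomputable def cost [MeasurableSpace Ω] (P : AverageProblem n m Ω) (μ : Measure Ω)
    (x : ℝ → Ω → Euc n) : EReal :=
  if Integrable (fun ω => P.g (x P.T ω) ω) μ then ((∫ ω, P.g (x P.T ω) ω ∂μ : ℝ) : EReal) else ⊤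

/-- `(u, {x(·,ω)})` is a `W^{1,1}`-local minimizer (with a finite cost). -/
def IsLocalMinimizer [TopologicalSpace Ω] [MeasurableSpace Ω] (P : AverageProblem n m Ω)
    (μ : Measure Ω) (u : ℝ → Euc m) (x : ℝ → Ω → Euc n) : Prop :=
  P.IsFeasible μ u x ∧ P.cost μ x ≠ ⊤ ∧
    ∃ ε > 0, ∀ (v : ℝ → Euc m) (y : ℝ → Ω → Euc n), P.IsFeasible μ v y →
      (∀ ω ∈ μ.support, normW11 P.T (fun t => x t ω - y t ω) ≤ ε) →
      P.cost μ x ≤ P.cost μ y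

/-- Measurability of `f(·,x,·,·)` and of the graph of `U`, non-emptiness of `U(t)`, and closedness of
the velocity sets `f(t,x,U(t),ω)` near the reference arcs. -/
structure MeasurableData [MeasurableSpace Ω] (P : AverageProblem n m Ω) (xbar : ℝ → Ω → Euc n)
    (δ : ℝ) : Prop where
  measurable_f : ∀ x : Euc n,
    Measurable (fun z : LebInterval P.T × Euc m × Ω => P.f z.1.val x z.2.1 z.2.2)
  nonempty_U : ∀ t ∈ Icc 0 P.T, (P.U t).Nonempty
  measurable_graph_U : MeasurableSet {z : LebInterval P.T × Euc m | z.2 ∈ P.U z.1.val}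
  isClosed_velocities : ∀ t ∈ Icc 0 P.T, ∀ ω, ∀ x ∈ Metric.closedBall (xbar t ω) δ,
    IsClosed ((fun u => P.f t x u ω) '' P.U t)

/-- `f` is bounded, and Lipschitz in `x` with an integrable rate, near the reference arcs. -/
def LipschitzBoundedDynamics (P : AverageProblem n m Ω) (xbar : ℝ → Ω → Euc n) (δ : ℝ) : Prop :=
  ∃ c > 0, ∃ k : ℝ → ℝ, IntegrableOn k (Icc 0 P.T) ∧
    ∀ᵐ t ∂(volume.restrict (Icc 0 P.T)), ∀ ω, ∀ u ∈ P.U t,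
      ∀ x ∈ Metric.closedBall (xbar t ω) δ,
        ‖P.f t x u ω‖ ≤ c ∧
        ∀ x' ∈ Metric.closedBall (xbar t ω) δ,
          ‖P.f t x u ω - P.f t x' u ω‖ ≤ k t * ‖x - x'‖

/-- Continuity of `f` in the parameter, in an `L¹`-in-time, uniform-in-`(x,u)` sense. -/
def ParameterModulus [PseudoMetricSpace Ω] (P : AverageProblem n m Ω) (xbar : ℝ → Ω → Euc n)
    (δ : ℝ) : Prop :=
  ∃ θ : ℝ≥0 → ℝ≥0, IsModulus θ ∧ ∀ ω ω₁ ω₂ : Ω,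
    ∫⁻ t in Icc 0 P.T, ⨆ x ∈ Metric.closedBall (xbar t ω) δ, ⨆ u ∈ P.U t,
      ‖P.f t x u ω₁ - P.f t x u ω₂‖ₑ ≤ (θ (nndist ω₁ ω₂) : ℝ≥0∞)

/-- `g(·,ω)` is differentiable on `x̄(T,ω) + δ𝔹`, and `∇ₓg` is continuous in `(x,ω)` there. -/
def SmoothCost [TopologicalSpace Ω] (P : AverageProblem n m Ω) (xbar : ℝ → Ω → Euc n)
    (δ : ℝ) : Prop :=
  (∀ ω, ∀ x ∈ Metric.closedBall (xbar P.T ω) δ, DifferentiableAt ℝ (fun y => P.g y ω) x) ∧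
  ContinuousOn (fun z : Euc n × Ω => gradient (fun y => P.g y z.2) z.1)
    {z | z.1 ∈ Metric.closedBall (xbar P.T z.2) δ}

/-- `g(·,ω)` is Lipschitz on `x̄(T,ω) + δ𝔹` for `ω ∈ supp μ`, with a `μ`-integrable constant. -/
def LipschitzCost [TopologicalSpace Ω] [MeasurableSpace Ω] (P : AverageProblem n m Ω)
    (μ : Measure Ω) (xbar : ℝ → Ω → Euc n) (δ : ℝ) : Prop :=
  ∃ k : Ω → ℝ, Integrable k μ ∧ ∀ ω ∈ μ.support,
    ∀ x ∈ Metric.closedBall (xbar P.T ω) δ, ∀ x' ∈ Metric.closedBall (xbar P.T ω) δ,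
      |P.g x ω - P.g x' ω| ≤ k ω * ‖x - x'‖

/-- `∇ₓf(t,x,u,ω)`, as a linear map. -/
noncomputable def gradF (P : AverageProblem n m Ω) (t : ℝ) (x : Euc n) (u : Euc m) (ω : Ω) :
    Euc n →L[ℝ] Euc n :=
  fderiv ℝ (fun y => P.f t y u ω) x

/-- `f(t,·,u,ω)` is continuously differentiable on `x̄(t,ω) + δ𝔹`, and `ω ↦ ∇ₓf(t,x,u,ω)` is
continuous uniformly with respect to `(t,x,u)`, `u ∈ U(t)`, where these gradients are defined. -/
def SmoothDynamics [PseudoMetricSpace Ω] (P : AverageProblem n m Ω) (xbar : ℝ → Ω → Euc n)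
    (δ : ℝ) : Prop :=
  (∀ᵐ t ∂(volume.restrict (Icc 0 P.T)), ∀ ω, ∀ u ∈ P.U t,
    (∀ x ∈ Metric.closedBall (xbar t ω) δ, DifferentiableAt ℝ (fun y => P.f t y u ω) x) ∧
    ContinuousOn (fun x => P.gradF t x u ω) (Metric.closedBall (xbar t ω) δ)) ∧
  ∀ ω₁ : Ω, ∀ ε > 0, ∃ r > 0, ∀ ω₂ : Ω, dist ω₁ ω₂ < r →
    ∀ᵐ t ∂(volume.restrict (Icc 0 P.T)), ∀ u ∈ P.U t,
      ∀ x ∈ Metric.closedBall (xbar t ω₁) δ ∩ Metric.closedBall (xbar t ω₂) δ,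
        ‖P.gradF t x u ω₁ - P.gradF t x u ω₂‖ ≤ ε

end AverageProblem

/-! The proof is a needle variation averaged over the parameter. The adjoint arcs are defined as
solutions of the linear backward equation with terminal value `-∇g`, so the adjoint equation and the
transversality condition hold by construction. Only the maximum condition uses optimality.

Suppose that a measurable control `v` raises the averaged Hamiltonian by at least `η > 0` at every
time of a non-null set `B`. Choose `τ ∈ B` all of whose neighbourhoods meet `B` in positive measure,
and replace `ubar` by `v` on the sets `A j = B ∩ closedBall τ (r / (j + 1))`. Picard iteration
around the reference arcs gives perturbed arcs at distance `O(|A j|)`, with a constant independent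
of `ω`. For each `ω`, pairing the adjoint arc with the variation of the state
(`IsAdjoint.inner_eq_integral`) shows that the cost changes by minus the Hamiltonian gain integrated
over `A j`, up to `o(|A j|)` (`IsAdjoint.tendsto_cost_quotient`). The quotients are dominated by a
multiple of the Lipschitz constant of `g`, so this may be integrated in `ω`. By Fubini the averaged
cost changes by at most `-η |A j| + o(|A j|)`, against local minimality
(`IsLocalMinimizer.not_improvable`). No density point is needed, since the gain is at least `η` at
each time of `B`.

Two measurability questions remain. Joint measurability in `(t, ω)` comes from continuity in `ω` of
the state and adjoint arcs, both consequences of Gronwall estimates (`IsControlledPair.continuous`,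
`IsAdjoint.continuous`). To produce `v` from a pointwise failure of the maximum condition, a null
set of times is discarded so that all data become Borel (`RegularTimes`); the pairs `(t, u)`
improving by a given margin then form a Borel set, and `exists_measurable_selection` supplies a
Borel selector over a non-null part of its projection. This rests on a capacitability argument for
analytic sets. -/

/-! ### Absolutely continuous curves. -/

section AbsolutelyContinuous

/-- The defining sums for `h` are termwise at most `C` times those for `x` and `y` over the same
intervals. Integrals, exponentials of integrals and inner products are all handled by this one
comparison. -/
theorem AbsolutelyContinuousOnInterval.of_dist_le {X Y Z : Type*} [PseudoMetricSpace X]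
    [PseudoMetricSpace Y] [PseudoMetricSpace Z] {x : ℝ → X} {y : ℝ → Y} {h : ℝ → Z} {a b : ℝ}
    (hx : AbsolutelyContinuousOnInterval x a b) (hy : AbsolutelyContinuousOnInterval y a b) (C : ℝ)
    (H : ∀ s ∈ uIcc a b, ∀ t ∈ uIcc a b,
      dist (h s) (h t) ≤ C * (dist (x s) (x t) + dist (y s) (y t))) :
    AbsolutelyContinuousOnInterval h a b := by
  unfold AbsolutelyContinuousOnInterval at *
  refine squeeze_zero' (Eventually.of_forall fun E => Finset.sum_nonneg fun i _ => dist_nonneg) ?_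
    (by simpa using (hx.add hy).const_mul C)
  filter_upwards [mem_inf_of_right (mem_principal_self _)] with E hE
  rw [← Finset.sum_add_distrib, Finset.mul_sum]
  exact Finset.sum_le_sum fun i hi => H _ (hE.1 i hi).1 _ (hE.1 i hi).2

variable {E : Type*} [NormedAddCommGroup E] [NormedSpace ℝ E]

theorem absolutelyContinuousOnInterval_integral {F : ℝ → E} {a b : ℝ} (hab : a ≤ b)
    (hF : IntervalIntegrable F volume a b) :
    AbsolutelyContinuousOnInterval (fun t => ∫ s in a..t, F s) a b := by
  have h := hF.norm.absolutelyContinuousOnInterval_intervalIntegral (c := a) left_mem_uIcc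
  refine AbsolutelyContinuousOnInterval.of_dist_le h h 1 fun s hs t ht => ?_
  rw [uIcc_of_le hab] at hs ht
  have hi : ∀ r ∈ Icc a b, IntervalIntegrable F volume a r := fun r hr =>
    hF.mono_set (by rw [uIcc_of_le hab, uIcc_of_le hr.1]; exact Icc_subset_Icc_right hr.2)
  rw [dist_eq_norm, dist_eq_norm, intervalIntegral.integral_interval_sub_left (hi s hs) (hi t ht),
    intervalIntegral.integral_interval_sub_left (hi s hs).norm (hi t ht).norm, Real.norm_eq_abs]
  have := intervalIntegral.norm_integral_le_abs_integral_norm (f := F) (a := t) (b := s)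
    (μ := volume)
  have := abs_nonneg (∫ x in t..s, ‖F x‖)
  linarith

/-- Subtracting the indefinite integral of `F` leaves, by Lebesgue differentiation, an absolutely
continuous curve with zero derivative almost everywhere, hence a constant. -/
theorem AbsolutelyContinuousOnInterval.eq_add_integral [CompleteSpace E] {x F : ℝ → E} {a b : ℝ}
    (hab : a ≤ b) (hx : AbsolutelyContinuousOnInterval x a b)
    (hd : ∀ᵐ t ∂(volume.restrict (Icc a b)), HasDerivAt x (F t) t)
    (hF : IntervalIntegrable F volume a b) {t : ℝ} (ht : t ∈ Icc a b) :
    x t = x a + ∫ s in a..t, F s := by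
  have h0 := hx.sub (absolutelyContinuousOnInterval_integral hab hF)
  rw [ae_restrict_iff' measurableSet_Icc] at hd
  obtain ⟨C, hC⟩ := h0.const_of_ae_hasDerivAt_zero (by
    filter_upwards [hd, hF.ae_hasDerivAt_integral] with s h1 h2 hs
    rw [uIcc_of_le hab] at hs h2
    simpa using (h1 hs).sub (h2 hs a ⟨le_rfl, hab⟩))
  rw [uIcc_of_le hab] at hC
  have h1 := hC t ht
  have h2 := hC a ⟨le_rfl, hab⟩
  simp only [Pi.sub_apply, intervalIntegral.integral_same, sub_zero] at h1 h2
  rw [h2, ← h1]; abel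

theorem AbsolutelyContinuousOnInterval.inner {F : Type*} [NormedAddCommGroup F]
    [InnerProductSpace ℝ F] {x y : ℝ → F} {a b : ℝ} (hx : AbsolutelyContinuousOnInterval x a b)
    (hy : AbsolutelyContinuousOnInterval y a b) :
    AbsolutelyContinuousOnInterval (fun t => inner ℝ (x t) (y t)) a b := by
  obtain ⟨C, hC⟩ := hx.exists_bound
  obtain ⟨D, hD⟩ := hy.exists_bound
  refine hx.of_dist_le hy (max C D) fun s hs t ht => ?_
  rw [dist_eq_norm, dist_eq_norm, dist_eq_norm]
  have : Inner.inner ℝ (x s) (y s) - Inner.inner ℝ (x t) (y t)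
      = Inner.inner ℝ (x s - x t) (y s) + Inner.inner ℝ (x t) (y s - y t) := by
    simp only [inner_sub_left, inner_sub_right]; ring
  rw [this]
  calc _ ≤ ‖x s - x t‖ * ‖y s‖ + ‖x t‖ * ‖y s - y t‖ :=
        (norm_add_le _ _).trans (add_le_add (norm_inner_le_norm _ _) (norm_inner_le_norm _ _))
    _ ≤ ‖x s - x t‖ * max C D + max C D * ‖y s - y t‖ := by
        gcongr
        · exact (hD s hs).trans (le_max_right _ _)
        · exact (hC t ht).trans (le_max_left _ _)
    _ = _ := by ring

end AbsolutelyContinuous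

/-! ### Gronwall inequalities with an integrable rate. -/

section Gronwall

/-- The weight `exp (2 ∫₀ᵗ k)`, adapted to a Lipschitz rate `k`. -/
noncomputable def expWeight (k : ℝ → ℝ) (t : ℝ) : ℝ := Real.exp (2 * ∫ s in (0 : ℝ)..t, k s)

theorem MeasureTheory.IntegrableOn.intervalIntegrable_of_mem {E : Type*} [NormedAddCommGroup E] {T : ℝ}
    {k : ℝ → E} (hk : IntegrableOn k (Icc 0 T)) {s t : ℝ} (hs : s ∈ Icc 0 T) (ht : t ∈ Icc 0 T) :
    IntervalIntegrable k volume s t :=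
  (hk.mono_set (uIcc_subset_Icc hs ht)).intervalIntegrable

variable {T : ℝ} {k : ℝ → ℝ}

theorem expWeight_pos (t : ℝ) : 0 < expWeight k t := Real.exp_pos _

theorem expWeight_mono (hk : IntegrableOn k (Icc 0 T)) (hk0 : ∀ t, 0 ≤ k t) {s t : ℝ} (hs : 0 ≤ s)
    (hst : s ≤ t) (ht : t ≤ T) : expWeight k s ≤ expWeight k t := by
  unfold expWeight
  gcongr
  have h0 : (0 : ℝ) ∈ Icc 0 T := ⟨le_rfl, hs.trans (hst.trans ht)⟩
  rw [← intervalIntegral.integral_add_adjacent_intervals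
    (hk.intervalIntegrable_of_mem h0 ⟨hs, hst.trans ht⟩)
    (hk.intervalIntegrable_of_mem ⟨hs, hst.trans ht⟩ ⟨hs.trans hst, ht⟩)]
  linarith [intervalIntegral.integral_nonneg hst (fun u _ => hk0 u) (μ := volume)]

theorem one_le_expWeight (hk : IntegrableOn k (Icc 0 T)) (hk0 : ∀ t, 0 ≤ k t) {t : ℝ}
    (ht : t ∈ Icc 0 T) : 1 ≤ expWeight k t := by
  simpa [expWeight] using expWeight_mono hk hk0 le_rfl ht.1 ht.2

theorem absolutelyContinuousOnInterval_expWeight (hk : IntegrableOn k (Icc 0 T)) {t : ℝ}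
    (ht : t ∈ Icc 0 T) : AbsolutelyContinuousOnInterval (expWeight k) 0 t := by
  have h0 : (0 : ℝ) ∈ Icc 0 T := ⟨le_rfl, ht.1.trans ht.2⟩
  have h := absolutelyContinuousOnInterval_integral ht.1 (hk.intervalIntegrable_of_mem h0 ht)
  obtain ⟨C, hC⟩ := h.exists_bound
  obtain ⟨K, hK⟩ := ContDiffOn.exists_lipschitzOnWith (n := 1) (s := Icc (-C) C)
    (f := fun x : ℝ => Real.exp (2 * x)) (by fun_prop) (by decide) (convex_Icc _ _) isCompact_Icc
  refine h.of_dist_le h K fun s hs r hr => ?_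
  have := hK.dist_le_mul _ (abs_le.1 (hC s hs)) _ (abs_le.1 (hC r hr))
  refine this.trans ?_
  gcongr
  exact le_add_of_nonneg_right dist_nonneg

theorem continuousOn_expWeight (hk : IntegrableOn k (Icc 0 T)) :
    ContinuousOn (expWeight k) (Icc 0 T) := by
  rcases le_or_gt 0 T with h | h
  · simpa [uIcc_of_le h] using
      (absolutelyContinuousOnInterval_expWeight hk (t := T) ⟨h, le_rfl⟩).continuousOn
  · simp [Icc_eq_empty (not_le.2 h)]

theorem integrableOn_mul_expWeight (hk : IntegrableOn k (Icc 0 T)) :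
    IntegrableOn (fun s => k s * expWeight k s) (Icc 0 T) :=
  hk.mul_continuousOn (continuousOn_expWeight hk) isCompact_Icc

theorem integral_mul_expWeight (hk : IntegrableOn k (Icc 0 T)) {t : ℝ} (ht : t ∈ Icc 0 T) :
    ∫ s in (0 : ℝ)..t, k s * expWeight k s = (expWeight k t - 1) / 2 := by
  have h0 : (0 : ℝ) ∈ Icc 0 T := ⟨le_rfl, ht.1.trans ht.2⟩
  have hd : ∀ᵐ s ∂(volume.restrict (Icc 0 t)),
      HasDerivAt (expWeight k) (2 * (k s * expWeight k s)) s := by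
    rw [ae_restrict_iff' measurableSet_Icc]
    filter_upwards [(hk.intervalIntegrable_of_mem h0 ht).ae_hasDerivAt_integral] with s hs hst
    rw [uIcc_of_le ht.1] at hs
    have := ((hs hst 0 ⟨le_rfl, ht.1⟩).const_mul 2).exp
    unfold expWeight
    convert this using 1; ring
  have := (absolutelyContinuousOnInterval_expWeight hk ht).eq_add_integral ht.1 hd
    (((integrableOn_mul_expWeight hk).intervalIntegrable_of_mem h0 ht).const_mul 2)
    ⟨ht.1, le_rfl⟩
  rw [intervalIntegral.integral_const_mul] at this
  have h1 : expWeight k 0 = 1 := by simp [expWeight]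
  linarith

/-- Gronwall's inequality with an integrable rate. -/
theorem le_mul_expWeight_of_le_integral (hk : IntegrableOn k (Icc 0 T)) (hk0 : ∀ t, 0 ≤ k t)
    {u : ℝ → ℝ} (hu : ContinuousOn u (Icc 0 T)) {a : ℝ} (ha : 0 ≤ a)
    (h : ∀ t ∈ Icc 0 T, u t ≤ a + ∫ s in (0 : ℝ)..t, k s * u s) {t : ℝ} (ht : t ∈ Icc 0 T) :
    u t ≤ 2 * a * expWeight k t := by
  have hW := continuousOn_expWeight hk
  obtain ⟨r, hr, hmax⟩ := isCompact_Icc.exists_isMaxOn ⟨t, ht⟩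
    (hu.div hW fun s _ => (expWeight_pos s).ne')
  -- Write `W` for the weight at the maximum point `r`. The factor 2 in the exponent makes
  -- integration against `k` halve the weight, so for `M > 0` the hypothesis at `r` gives `M * W ≤ a
  -- + M * (W - 1) / 2`. Since `W ≥ 1`, this bounds `M` by `2 * a`.
  set M := u r / expWeight k r with hM
  have hle : ∀ s ∈ Icc 0 T, u s ≤ M * expWeight k s := fun s hs => by
    have := hmax hs
    change u s / expWeight k s ≤ M at this
    rwa [div_le_iff₀ (expWeight_pos s)] at this
  have hM2 : M ≤ 2 * a := by
    rcases le_or_gt M 0 with h0 | h0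
    · linarith
    have h0T : (0 : ℝ) ∈ Icc 0 T := ⟨le_rfl, ht.1.trans ht.2⟩
    have hint : ∫ s in (0 : ℝ)..r, k s * u s ≤ ∫ s in (0 : ℝ)..r, M * (k s * expWeight k s) := by
      refine intervalIntegral.integral_mono_on hr.1
        ((hk.mul_continuousOn hu isCompact_Icc).intervalIntegrable_of_mem h0T hr)
        (((integrableOn_mul_expWeight hk).intervalIntegrable_of_mem h0T hr).const_mul M)
        fun s hs => ?_
      have := mul_le_mul_of_nonneg_left (hle s ⟨hs.1, hs.2.trans hr.2⟩) (hk0 s)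
      linarith
    rw [intervalIntegral.integral_const_mul, integral_mul_expWeight hk hr] at hint
    have h1 := h r hr
    have h2 : u r = M * expWeight k r := by rw [hM, div_mul_cancel₀ _ (expWeight_pos r).ne']
    have h3 := one_le_expWeight hk hk0 hr
    nlinarith
  exact (hle t ht).trans (mul_le_mul_of_nonneg_right hM2 (expWeight_pos t).le)

/-- Gronwall's inequality, when the integral inequality holds as long as `u ≤ r`. -/
theorem le_mul_expWeight_of_le_integral_of_le (hk : IntegrableOn k (Icc 0 T)) (hk0 : ∀ t, 0 ≤ k t)
    {u : ℝ → ℝ} (hu : ContinuousOn u (Icc 0 T)) {a r : ℝ} (ha : 0 ≤ a)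
    (har : 2 * a * expWeight k T < r)
    (h : ∀ t ∈ Icc 0 T, (∀ s ∈ Icc 0 t, u s ≤ r) → u t ≤ a + ∫ s in (0 : ℝ)..t, k s * u s)
    (h0 : u 0 ≤ r) {t : ℝ} (ht : t ∈ Icc 0 T) :
    u t ≤ 2 * a * expWeight k t := by
  suffices hr : ∀ t ∈ Icc 0 T, u t ≤ r from
    le_mul_expWeight_of_le_integral hk hk0 hu ha
      (fun t ht => h t ht fun s hs => hr s ⟨hs.1, hs.2.trans ht.2⟩) ht
  have hT : 0 ≤ T := ht.1.trans ht.2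
  have hsub : ∀ t ∈ Icc 0 T, (∀ s ∈ Icc 0 t, u s ≤ r) → u t < r := fun t ht hs => by
    have := le_mul_expWeight_of_le_integral (T := t) (hk.mono_set (Icc_subset_Icc_right ht.2)) hk0
      (hu.mono (Icc_subset_Icc_right ht.2)) ha
      (fun s hst => h s ⟨hst.1, hst.2.trans ht.2⟩ fun q hq => hs q ⟨hq.1, hq.2.trans hst.2⟩)
      ⟨ht.1, le_rfl⟩
    have h2 := expWeight_mono hk hk0 ht.1 ht.2 le_rfl
    nlinarith
  by_contra! hcon
  obtain ⟨q, hq, hqr⟩ := hcon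
  have hcl : IsClosed (Icc 0 T ∩ u ⁻¹' Ici r) := hu.preimage_isClosed_of_isClosed isClosed_Icc
    isClosed_Ici
  have hne : (Icc 0 T ∩ u ⁻¹' Ici r).Nonempty := ⟨q, hq, hqr.le⟩
  have hbdd : BddBelow (Icc 0 T ∩ u ⁻¹' Ici r) := ⟨0, fun s hs => hs.1.1⟩
  -- `m` is the first time at which `u` reaches `r`. The integral inequality is available up to `m`,
  -- and `hsub` then makes `u m` strictly smaller than `r`.
  set m := sInf (Icc 0 T ∩ u ⁻¹' Ici r) with hm
  have hmem : m ∈ Icc 0 T ∩ u ⁻¹' Ici r := hcl.csInf_mem hne hbdd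
  have hlt : ∀ s ∈ Ico 0 m, u s < r := fun s hs => by
    by_contra! hc
    exact absurd (csInf_le hbdd ⟨⟨hs.1, hs.2.le.trans hmem.1.2⟩, hc⟩) (not_le.2 hs.2)
  have hmr : u m ≤ r := by
    rcases hmem.1.1.eq_or_lt with h1 | h1
    · rwa [← h1]
    · have hc : ContinuousWithinAt u (Ico 0 m) m := (hu m hmem.1).mono
        fun s hs => ⟨hs.1, hs.2.le.trans hmem.1.2⟩
      have : (𝓝[Ico 0 m] m).NeBot := by
        rw [← mem_closure_iff_nhdsWithin_neBot, closure_Ico h1.ne]; exact ⟨h1.le, le_rfl⟩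
      exact le_of_tendsto hc (eventually_mem_nhdsWithin.mono fun s hs => (hlt s hs).le)
  refine absurd (hsub m hmem.1 fun s hs => ?_) (not_lt.2 hmem.2)
  rcases hs.2.eq_or_lt with h1 | h1
  · rwa [h1]
  · exact (hlt s ⟨hs.1, h1⟩).le

end Gronwall

/-! ### Carathéodory existence near an approximate solution. -/

section Existence

variable {E : Type*} [NormedAddCommGroup E] [NormedSpace ℝ E] {T : ℝ} {k : ℝ → ℝ}

/-- Two curves in a tube where `F` is Lipschitz with rate `k`: the weighted sup distance is halved by
integrating `F` along the curves. -/
theorem norm_integral_sub_integral_le_expWeight (hk : IntegrableOn k (Icc 0 T))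
    (hk0 : ∀ t, 0 ≤ k t) {F : ℝ → E → E} {y y' : ℝ → E} {b : ℝ}
    (hFy : IntegrableOn (fun t => F t (y t)) (Icc 0 T))
    (hFy' : IntegrableOn (fun t => F t (y' t)) (Icc 0 T))
    (hL : ∀ᵐ t ∂(volume.restrict (Icc 0 T)), ‖F t (y t) - F t (y' t)‖ ≤ k t * ‖y t - y' t‖)
    (hb : ∀ t ∈ Icc 0 T, ‖y t - y' t‖ ≤ b * expWeight k t) {t : ℝ} (ht : t ∈ Icc 0 T) :
    ‖(∫ s in (0 : ℝ)..t, F s (y s)) - ∫ s in (0 : ℝ)..t, F s (y' s)‖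
      ≤ b * ((expWeight k t - 1) / 2) := by
  have h0T : (0 : ℝ) ∈ Icc 0 T := ⟨le_rfl, ht.1.trans ht.2⟩
  rw [← intervalIntegral.integral_sub (hFy.intervalIntegrable_of_mem h0T ht)
    (hFy'.intervalIntegrable_of_mem h0T ht), ← integral_mul_expWeight hk ht,
    ← intervalIntegral.integral_const_mul]
  refine intervalIntegral.norm_integral_le_of_norm_le ht.1 ?_
    (((integrableOn_mul_expWeight hk).intervalIntegrable_of_mem h0T ht).const_mul b)
  rw [ae_restrict_iff' measurableSet_Icc] at hL
  filter_upwards [hL] with s hs hst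
  have hsT : s ∈ Icc 0 T := ⟨hst.1.le, hst.2.trans ht.2⟩
  have := mul_le_mul_of_nonneg_left (hb s hsT) (hk0 s)
  linarith [hs hsT]

theorem MeasureTheory.IntegrableOn.continuousOn_integral {F : ℝ → E} (hF : IntegrableOn F (Icc 0 T)) :
    ContinuousOn (fun t => ∫ s in (0 : ℝ)..t, F s) (Icc 0 T) := by
  rcases le_or_gt 0 T with h | h
  · simpa [uIcc_of_le h] using (absolutelyContinuousOnInterval_integral h
      (hF.intervalIntegrable_of_mem ⟨le_rfl, h⟩ ⟨h, le_rfl⟩)).continuousOn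
  · simp [Icc_eq_empty (not_le.2 h)]

/-- Carathéodory existence theorem near an approximate solution `z`, by Picard iteration. -/
theorem exists_integral_curve_near [CompleteSpace E] (hk : IntegrableOn k (Icc 0 T))
    (hk0 : ∀ t, 0 ≤ k t) {F : ℝ → E → E} {z : ℝ → E} (hz : ContinuousOn z (Icc 0 T)) {r a : ℝ}
    (x₀ : E)
    (hF : ∀ y : ℝ → E, ContinuousOn y (Icc 0 T) →
      (∀ t ∈ Icc 0 T, y t ∈ Metric.closedBall (z t) r) →
      IntegrableOn (fun t => F t (y t)) (Icc 0 T))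
    (hL : ∀ᵐ t ∂(volume.restrict (Icc 0 T)), ∀ x ∈ Metric.closedBall (z t) r,
      ∀ x' ∈ Metric.closedBall (z t) r, ‖F t x - F t x'‖ ≤ k t * ‖x - x'‖)
    (hres : ∀ t ∈ Icc 0 T, ‖x₀ + (∫ s in (0 : ℝ)..t, F s (z s)) - z t‖ ≤ a) (ha : 0 ≤ a)
    (har : 2 * a * expWeight k T ≤ r) :
    ∃ y : ℝ → E, ContinuousOn y (Icc 0 T) ∧
      (∀ t ∈ Icc 0 T, y t = x₀ + ∫ s in (0 : ℝ)..t, F s (y s)) ∧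
      ∀ t ∈ Icc 0 T, ‖y t - z t‖ ≤ 2 * a * expWeight k t := by
  have htube : ∀ y : ℝ → E, (∀ t ∈ Icc 0 T, ‖y t - z t‖ ≤ 2 * a * expWeight k t) →
      ∀ t ∈ Icc 0 T, y t ∈ Metric.closedBall (z t) r := fun y hy t ht => by
    rw [mem_closedBall_iff_norm]
    have := expWeight_mono hk hk0 ht.1 ht.2 le_rfl
    have := hy t ht
    nlinarith
  have hstep : ∀ y y' : ℝ → E, ContinuousOn y (Icc 0 T) → ContinuousOn y' (Icc 0 T) →
      (∀ t ∈ Icc 0 T, ‖y t - z t‖ ≤ 2 * a * expWeight k t) →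
      (∀ t ∈ Icc 0 T, ‖y' t - z t‖ ≤ 2 * a * expWeight k t) →
      ∀ b, (∀ t ∈ Icc 0 T, ‖y t - y' t‖ ≤ b * expWeight k t) → ∀ t ∈ Icc 0 T,
      ‖(∫ s in (0 : ℝ)..t, F s (y s)) - ∫ s in (0 : ℝ)..t, F s (y' s)‖
        ≤ b * ((expWeight k t - 1) / 2) := fun y y' hc hc' hy hy' b hb t ht => by
    refine norm_integral_sub_integral_le_expWeight hk hk0 (hF y hc (htube y hy))
      (hF y' hc' (htube y' hy')) ?_ hb ht
    filter_upwards [hL, ae_restrict_mem measurableSet_Icc] with s hs hsT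
    exact hs _ (htube y hy s hsT) _ (htube y' hy' s hsT)
  let Y : ℕ → ℝ → E := fun j => Nat.rec z (fun _ y t => x₀ + ∫ s in (0 : ℝ)..t, F s (y s)) j
  have hY0 : Y 0 = z := rfl
  have hYs : ∀ j t, Y (j + 1) t = x₀ + ∫ s in (0 : ℝ)..t, F s (Y j s) := fun j t => rfl
  have hz2 : ∀ t ∈ Icc 0 T, ‖z t - z t‖ ≤ 2 * a * expWeight k t := fun t _ => by
    simpa using mul_nonneg (by linarith) (expWeight_pos t).le
  have hY : ∀ j, ContinuousOn (Y j) (Icc 0 T) ∧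
      (∀ t ∈ Icc 0 T, ‖Y j t - z t‖ ≤ 2 * a * expWeight k t) := fun j => by
    induction j with
    | zero => exact ⟨hz, hz2⟩
    | succ j ih =>
      refine ⟨continuousOn_const.add (hF _ ih.1 (htube _ ih.2)).continuousOn_integral,
        fun t ht => ?_⟩
      -- With `W` the weight at `t`, the contraction contributes at most `a * (W - 1)` and the
      -- residual of `z` at most `a`. The sum `a * W` keeps the next iterate in the tube of width `2
      -- * a * W`.
      have h1 := hstep _ _ ih.1 hz ih.2 hz2 _ ih.2 t ht
      have h2 := hres t ht
      rw [hYs]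
      calc _ = ‖((∫ s in (0 : ℝ)..t, F s (Y j s)) - ∫ s in (0 : ℝ)..t, F s (z s))
            + (x₀ + (∫ s in (0 : ℝ)..t, F s (z s)) - z t)‖ := by congr 1; abel
        _ ≤ _ := norm_add_le _ _
        _ ≤ _ := by nlinarith [expWeight_pos (k := k) t]
  have hYd : ∀ j, ∀ t ∈ Icc 0 T, ‖Y j t - Y (j + 1) t‖ ≤ a * (1 / 2) ^ j * expWeight k t :=
    fun j => by
    induction j with
    | zero =>
      intro t ht
      have h2 := hres t ht
      have := one_le_expWeight hk hk0 ht
      rw [hYs, norm_sub_rev, hY0]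
      nlinarith
    | succ j ih =>
      intro t ht
      have h1 := hstep _ _ (hY j).1 (hY (j + 1)).1 (hY j).2 (hY (j + 1)).2 _ ih t ht
      rw [hYs, hYs (j + 1), add_sub_add_left_eq_sub]
      refine h1.trans ?_
      have : 0 ≤ a * (1 / 2) ^ j := by positivity
      rw [pow_succ]
      nlinarith
  have hlim : ∀ t : ℝ, ∃ l : E, t ∈ Icc 0 T → Tendsto (fun j => Y j t) atTop (𝓝 l) := fun t => by
    by_cases ht : t ∈ Icc 0 T
    · have : CauchySeq fun j => Y j t :=
        cauchySeq_of_le_geometric (1 / 2) (a * expWeight k t) (by norm_num) fun j => by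
          rw [dist_eq_norm]; exact (hYd j t ht).trans (le_of_eq (by ring))
      obtain ⟨l, hl⟩ := cauchySeq_tendsto_of_complete this
      exact ⟨l, fun _ => hl⟩
    · exact ⟨0, fun h => absurd h ht⟩
  choose y hy using hlim
  have hyd : ∀ j, ∀ t ∈ Icc 0 T, ‖Y j t - y t‖ ≤ 2 * a * (1 / 2) ^ j * expWeight k t :=
    fun j t ht => by
    have := dist_le_of_le_geometric_of_tendsto (1 / 2) (a * expWeight k t) (by norm_num)
      (fun j => by rw [dist_eq_norm]; exact (hYd j t ht).trans (le_of_eq (by ring))) (hy t ht) j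
    rw [dist_eq_norm] at this
    exact this.trans (le_of_eq (by ring))
  have hgeo : Tendsto (fun j : ℕ => 2 * a * (1 / 2 : ℝ) ^ j) atTop (𝓝 0) := by
    simpa using (tendsto_pow_atTop_nhds_zero_of_lt_one (r := (1 / 2 : ℝ)) (by norm_num)
      (by norm_num)).const_mul (2 * a)
  have hyz : ∀ t ∈ Icc 0 T, ‖y t - z t‖ ≤ 2 * a * expWeight k t := fun t ht =>
    le_of_tendsto ((hy t ht).sub_const _).norm (Eventually.of_forall fun j => (hY j).2 t ht)
  have hyc : ContinuousOn y (Icc 0 T) := by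
    refine TendstoUniformlyOn.continuousOn (F := Y) (p := atTop) ?_
      (Eventually.of_forall fun j => (hY j).1).frequently
    rw [Metric.tendstoUniformlyOn_iff]
    intro ε hε
    have := hgeo.mul_const (expWeight k T)
    rw [zero_mul] at this
    filter_upwards [this.eventually (gt_mem_nhds hε)] with j hj t ht
    rw [dist_comm, dist_eq_norm]
    refine ((hyd j t ht).trans ?_).trans_lt hj
    exact mul_le_mul_of_nonneg_left (expWeight_mono hk hk0 ht.1 ht.2 le_rfl) (by positivity)
  refine ⟨y, hyc, fun t ht => ?_, hyz⟩
  have h1 : Tendsto (fun j => Y (j + 1) t) atTop (𝓝 (y t)) := (hy t ht).comp (tendsto_add_atTop_nat 1)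
  refine tendsto_nhds_unique h1 ?_
  simp_rw [hYs]
  refine tendsto_const_nhds.add (tendsto_iff_norm_sub_tendsto_zero.2 ?_)
  have h2 := hgeo.mul_const ((expWeight k t - 1) / 2)
  rw [zero_mul] at h2
  exact squeeze_zero (fun _ => norm_nonneg _)
    (fun j => hstep _ _ (hY j).1 hyc (hY j).2 hyz _ (hyd j) t ht) h2

end Existence

/-! ### Measurable selection through capacitability. -/

section Selection

/-- A sequence is encoded by the characteristic function of its graph, which is a point of the
Cantor set. The resulting `e` acts as a height function: minimizing it over a compact fibre singles
out one point. -/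
theorem exists_continuous_injective_nat_nat_real :
    ∃ e : (ℕ → ℕ) → ℝ, Continuous e ∧ Function.Injective e := by
  let b : (ℕ → ℕ) → (ℕ → Bool) := fun x i => decide (x (Nat.unpair i).1 = (Nat.unpair i).2)
  have hb : Continuous b := by
    refine continuous_pi fun i => ?_
    exact (continuous_of_discreteTopology (f := fun j : ℕ => decide (j = (Nat.unpair i).2))).comp
      (continuous_apply _)
  have hbi : Function.Injective b := fun x y h => by
    ext i
    have := congrFun h (Nat.pair i (x i))
    simp only [b, Nat.unpair_pair, decide_true, eq_comm (a := true), decide_eq_true_eq] at this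
    exact this.symm
  exact ⟨fun x => (cantorSetHomeomorphNatToBool.symm (b x) : ℝ),
    continuous_subtype_val.comp (cantorSetHomeomorphNatToBool.symm.continuous.comp hb),
    Subtype.val_injective.comp (cantorSetHomeomorphNatToBool.symm.injective.comp hbi)⟩

/-- A continuous function on the Baire space whose image has measure `> r` has a compact set with
image of measure `≥ r`. -/
theorem exists_isCompact_le_measure_image {X : Type*} [TopologicalSpace X] [MeasurableSpace X]
    (ν : Measure X) [ν.OuterRegular] {φ : (ℕ → ℕ) → X} (hφ : Continuous φ) {r : ℝ≥0∞}
    (hr : r < ν (range φ)) : ∃ K : Set (ℕ → ℕ), IsCompact K ∧ r ≤ ν (φ '' K) := by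
  -- Continuity from below, valid also for non-measurable sets: bounding one coordinate by a large
  -- `n` keeps the image of measure `> r`. Doing this for all coordinates in turn gives the bounds
  -- that define the compact box `K`.
  have hstep : ∀ (k : ℕ) (A : Set (ℕ → ℕ)), ∃ n : ℕ, r < ν (φ '' A) →
      r < ν (φ '' (A ∩ {x | x k ≤ n})) := fun k A => by
    by_cases hA : r < ν (φ '' A)
    · have hmono : Monotone fun n : ℕ => φ '' (A ∩ {x | x k ≤ n}) := fun i j hij =>
        image_mono (inter_subset_inter_right _ fun x hx => le_trans (α := ℕ) hx hij)
      have hU : φ '' A = ⋃ n : ℕ, φ '' (A ∩ {x | x k ≤ n}) := by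
        rw [← image_iUnion, ← inter_iUnion]
        congr 1
        exact (inter_eq_left.2 fun x _ => mem_iUnion.2 ⟨x k, le_refl (x k)⟩).symm
      have h2 := hA
      rw [hU, hmono.measure_iUnion, lt_iSup_iff] at h2
      exact h2.imp fun n hn _ => hn
    · exact ⟨0, fun h => absurd h hA⟩
  choose N hN using hstep
  let C : ℕ → Set (ℕ → ℕ) := fun k => Nat.rec univ (fun k A => A ∩ {x | x k ≤ N k A}) k
  have hC : ∀ k, r < ν (φ '' C k) := fun k => by
    induction k with
    | zero => simpa [C] using hr
    | succ k ih => exact hN k _ ih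
  have hCmem : ∀ k x, (∀ i < k, x i ≤ N i (C i)) → x ∈ C k := fun k => by
    induction k with
    | zero => exact fun x _ => mem_univ x
    | succ k ih => exact fun x hx => ⟨ih x fun i hi => hx i (hi.trans k.lt_succ_self),
        hx k k.lt_succ_self⟩
  have hCle : ∀ k x, x ∈ C k → ∀ i < k, x i ≤ N i (C i) := fun k => by
    induction k with
    | zero => exact fun x _ i hi => absurd hi (Nat.not_lt_zero _)
    | succ k ih =>
      intro x hx i hi
      rcases Nat.lt_succ_iff_lt_or_eq.1 hi with h | h
      · exact ih x hx.1 i h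
      · subst h; exact hx.2
  let K : Set (ℕ → ℕ) := univ.pi fun i => Iic (N i (C i))
  have hK : IsCompact K := isCompact_univ_pi fun i => (finite_Iic _).isCompact
  refine ⟨K, hK, ?_⟩
  -- The sets `C k` restrict only the first `k` coordinates, so `K` is their intersection and
  -- continuity from above is not at hand. Instead, an open `V ⊇ φ '' K` of measure `< r` cannot
  -- contain any `φ '' C k`, and a compactness argument contradicts this.
  by_contra! hlt
  obtain ⟨V, hKV, hV, hVr⟩ := (φ '' K).exists_isOpen_lt_of_lt r hlt
  have hex : ∀ k, ∃ x ∈ C k, φ x ∉ V := fun k => by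
    by_contra! hc
    exact absurd ((hC k).trans_le (measure_mono (image_subset_iff.2 hc))) (not_lt.2 hVr.le)
  choose x hxC hxV using hex
  -- Truncation moves `x k` into `K` without changing its first `k` coordinates, so a subsequential
  -- limit of the `y k` in `K` is also a limit of the corresponding `x k`.
  let y : ℕ → ℕ → ℕ := fun k i => if i < k then x k i else 0
  have hyK : ∀ k, y k ∈ K := fun k i _ => by
    by_cases h : i < k
    · simpa [y, h] using hCle k _ (hxC k) i h
    · simp [y, h]
  obtain ⟨z, hz, s, hs, hlim⟩ := hK.tendsto_subseq hyK
  have hxz : Tendsto (x ∘ s) atTop (𝓝 z) := by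
    rw [tendsto_pi_nhds] at hlim ⊢
    intro i
    refine (hlim i).congr' ?_
    filter_upwards [hs.tendsto_atTop.eventually_gt_atTop i] with j hj
    simp [y, hj]
  have : ∀ᶠ j in atTop, φ ((x ∘ s) j) ∈ V :=
    ((hφ.tendsto z).comp hxz).eventually (hV.mem_nhds (hKV (mem_image_of_mem _ hz)))
  obtain ⟨j, hj⟩ := this.exists
  exact hxV _ hj

/-- A continuous function on a compact subset of the Baire space has a Borel right inverse. -/
theorem exists_measurable_rightInverse_of_isCompact {X : Type*} [TopologicalSpace X] [T2Space X]
    [MeasurableSpace X] [OpensMeasurableSpace X] {φ : (ℕ → ℕ) → X} (hφ : Continuous φ)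
    {K : Set (ℕ → ℕ)} (hK : IsCompact K) :
    ∃ σ : X → (ℕ → ℕ), Measurable σ ∧ ∀ t ∈ φ '' K, φ (σ t) = t := by
  classical
  obtain ⟨e, he, hei⟩ := exists_continuous_injective_nat_nat_real
  -- Over `φ '' K` the selected point minimizes `e` on the fibre. Elsewhere it is constantly `0`, so
  -- that the sublevel sets of `e ∘ σ` are explicit.
  have hmin : ∀ t : X, ∃ x : ℕ → ℕ, (t ∈ φ '' K → x ∈ K ∧ φ x = t ∧
      ∀ y ∈ K, φ y = t → e x ≤ e y) ∧ (t ∉ φ '' K → x = 0) := fun t => by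
    by_cases ht : t ∈ φ '' K
    · obtain ⟨y, hy, hyt⟩ := ht
      obtain ⟨x, hx, hxm⟩ := (hK.inter_right ((isClosed_singleton (x := t)).preimage
        hφ)).exists_isMinOn ⟨y, hy, hyt⟩ he.continuousOn
      exact ⟨x, fun _ => ⟨hx.1, hx.2, fun y hy hyt => hxm ⟨hy, hyt⟩⟩,
        fun h => absurd ⟨y, hy, hyt⟩ h⟩
    · exact ⟨0, fun h => absurd h ht, fun _ => rfl⟩
  choose σ hσ hσ0 using hmin
  refine ⟨σ, ?_, fun t ht => (hσ t ht).2.1⟩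
  have : BorelSpace (ℕ → ℕ) := Pi.borelSpace
  have hme : MeasurableEmbedding e := he.measurableEmbedding hei
  rw [← hme.measurable_comp_iff]
  refine measurable_of_Iic fun a => ?_
  have h1 : MeasurableSet (φ '' (K ∩ e ⁻¹' Iic a)) :=
    ((hK.inter_right (isClosed_Iic.preimage he)).image hφ).isClosed.measurableSet
  have h2 : MeasurableSet (φ '' K) := (hK.image hφ).isClosed.measurableSet
  -- A fibre has minimal height at most `a` exactly when it meets the compact set `K ∩ e ⁻¹' Iic a`;
  -- the image of that set is compact, hence closed.
  have : (e ∘ σ) ⁻¹' Iic a = φ '' (K ∩ e ⁻¹' Iic a) ∪ ((φ '' K)ᶜ ∩ {_t | e 0 ≤ a}) := by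
    ext t
    by_cases ht : t ∈ φ '' K
    · simp only [mem_preimage, Function.comp, mem_Iic, mem_union, mem_inter_iff, mem_compl_iff, ht,
        not_true, false_and, or_false]
      constructor
      · exact fun h => ⟨σ t, ⟨(hσ t ht).1, h⟩, (hσ t ht).2.1⟩
      · rintro ⟨y, ⟨hyK, hya⟩, hyt⟩
        exact ((hσ t ht).2.2 y hyK hyt).trans hya
    · have h3 : t ∉ φ '' (K ∩ e ⁻¹' Iic a) := fun h => ht (image_mono inter_subset_left h)
      simp [h3, ht, hσ0 t ht, -mem_image]
  rw [this]
  exact h1.union (h2.compl.inter (MeasurableSet.const _))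

/-- Measurable selection: a Borel set with non-null projection contains the graph of a Borel function
on a non-null Borel set. -/
theorem exists_measurable_selection {X Y : Type*} [TopologicalSpace X] [PolishSpace X]
    [MeasurableSpace X] [BorelSpace X] [TopologicalSpace Y] [PolishSpace Y] [MeasurableSpace Y]
    [BorelSpace Y] (ν : Measure X) [ν.OuterRegular] {S : Set (X × Y)} (hS : MeasurableSet S)
    (hpos : ν (Prod.fst '' S) ≠ 0) :
    ∃ (B : Set X) (v : X → Y), MeasurableSet B ∧ ν B ≠ 0 ∧ Measurable v ∧
      ∀ t ∈ B, (t, v t) ∈ S := by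
  have hA := hS.analyticSet
  rw [AnalyticSet] at hA
  rcases hA with rfl | ⟨h, hc, rfl⟩
  · simp at hpos
  rw [← range_comp] at hpos
  have hφ : Continuous (Prod.fst ∘ h) := continuous_fst.comp hc
  obtain ⟨r, hr0, hr⟩ := exists_between (pos_iff_ne_zero.2 hpos)
  obtain ⟨K, hK, hKr⟩ := exists_isCompact_le_measure_image ν hφ hr
  obtain ⟨σ, hσ, hσK⟩ := exists_measurable_rightInverse_of_isCompact hφ hK
  refine ⟨Prod.fst ∘ h '' K, fun t => (h (σ t)).2, (hK.image hφ).isClosed.measurableSet,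
    (hr0.trans_le hKr).ne', ?_, fun t ht => ?_⟩
  · have : BorelSpace (ℕ → ℕ) := Pi.borelSpace
    exact (hc.measurable.comp hσ).snd
  · exact ⟨σ t, Prod.ext (hσK t ht) rfl⟩

end Selection

/-! ### From Lebesgue to Borel measurability in time. -/

section Borelization

variable {T : ℝ} {Y : Type*} [MeasurableSpace Y]

theorem measurable_lebInterval_val : Measurable (LebInterval.val : LebInterval T → ℝ) :=
  (measurable_subtype_coe (p := fun s => s ∈ Icc (0 : ℝ) T)).nullMeasurable.measurable'

/-- An `ℒ × 𝒴`-measurable set is `ℬ × 𝒴`-measurable away from a null set of times. -/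
theorem exists_null_measurableSet_inter {S : Set (LebInterval T × Y)} (hS : MeasurableSet S) :
    ∃ N : Set ℝ, volume N = 0 ∧ ∀ I, MeasurableSet I → I ⊆ Icc 0 T \ N →
      MeasurableSet {z : ℝ × Y | z.1 ∈ I ∧
        ∃ t : LebInterval T, t.val = z.1 ∧ (t, z.2) ∈ S} := by
  rw [← generateFrom_prod] at hS
  induction S, hS using MeasurableSpace.generateFrom_induction with
  | hC S hS _ =>
    -- For a rectangle, the Lebesgue factor agrees with a Borel set off a null set, taken as `N`.
    -- Quantifying over every Borel `I` avoiding `N` lets exceptional sets be enlarged, which makes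
    -- the countable union step work.
    obtain ⟨s, hs, t, ht, rfl⟩ := hS
    have hs' : NullMeasurableSet (α := Icc (0 : ℝ) T) s
      (Measure.comap Subtype.val (volume : Measure ℝ)) := hs
    obtain ⟨s', -, hs'm, hss'⟩ := hs'.exists_measurable_superset_ae_eq
    obtain ⟨S', hS', rfl⟩ := hs'm
    have h0 : (Measure.comap Subtype.val (volume : Measure ℝ))
        {x : Icc (0 : ℝ) T | ¬ (x ∈ (Subtype.val ⁻¹' S' : Set (Icc (0 : ℝ) T)) ↔ x ∈ s)} = 0 :=
      ae_iff.1 (hss'.mem_iff)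
    refine ⟨Subtype.val '' {x : Icc (0 : ℝ) T | ¬ (x ∈ (Subtype.val ⁻¹' S' : Set (Icc (0 : ℝ) T))
      ↔ x ∈ s)}, ?_, fun I hI hIN => ?_⟩
    · rwa [(MeasurableEmbedding.subtype_coe measurableSet_Icc).comap_apply] at h0
    · convert (hI.inter hS').prod ht using 1
      ext ⟨r, y⟩
      simp only [mem_ofPred_eq, mem_prod, mem_inter_iff]
      constructor
      · rintro ⟨hr, q, rfl, hqs, hy⟩
        refine ⟨⟨hr, ?_⟩, hy⟩
        by_contra hc
        exact (hIN hr).2 ⟨q, fun h => hc (h.2 hqs), rfl⟩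
      · rintro ⟨⟨hr, hrS⟩, hy⟩
        refine ⟨hr, ⟨r, (hIN hr).1⟩, rfl, ?_, hy⟩
        by_contra hc
        exact (hIN hr).2 ⟨⟨r, (hIN hr).1⟩, fun h => hc (h.1 hrS), rfl⟩
  | empty => exact ⟨∅, by simp, fun I _ _ => by simp⟩
  | compl S _ ih =>
    obtain ⟨N, hN, h⟩ := ih
    refine ⟨N, hN, fun I hI hIN => ?_⟩
    convert (hI.prod MeasurableSet.univ).diff (h I hI hIN) using 1
    ext ⟨r, y⟩
    simp only [mem_ofPred_eq, Set.mem_sdiff, mem_prod, mem_univ, and_true, mem_compl_iff]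
    refine and_congr_right fun hr => ?_
    constructor
    · rintro ⟨t, rfl, ht⟩ ⟨_, t', ht', h'⟩
      exact ht (by rwa [← Subtype.val_injective (p := fun s => s ∈ Icc (0 : ℝ) T) ht'])
    · intro hn
      exact ⟨⟨r, (hIN hr).1⟩, rfl, fun hS => hn ⟨hr, _, rfl, hS⟩⟩
  | iUnion S _ ih =>
    choose N hN h using ih
    refine ⟨⋃ i, N i, measure_iUnion_null hN, fun I hI hIN => ?_⟩
    convert MeasurableSet.iUnion fun i => h i I hI fun t ht =>
      ⟨(hIN ht).1, fun hc => (hIN ht).2 (mem_iUnion_of_mem i hc)⟩ using 1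
    ext ⟨r, y⟩
    simp only [mem_iUnion, mem_ofPred_eq]
    tauto

theorem exists_null_measurableSet_and {p : ℝ → Y → Prop}
    (hp : MeasurableSet {z : LebInterval T × Y | p z.1.val z.2}) :
    ∃ N : Set ℝ, volume N = 0 ∧ ∀ I, MeasurableSet I → I ⊆ Icc 0 T \ N →
      MeasurableSet {z : ℝ × Y | z.1 ∈ I ∧ p z.1 z.2} := by
  obtain ⟨N, hN, h⟩ := exists_null_measurableSet_inter hp
  refine ⟨N, hN, fun I hI hIN => ?_⟩
  convert h I hI hIN using 1
  ext ⟨r, y⟩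
  refine and_congr_right fun hr => ⟨fun h => ⟨⟨r, (hIN hr).1⟩, rfl, h⟩, ?_⟩
  rintro ⟨t, rfl, ht⟩
  exact ht

/-- An `ℒ × 𝒴`-measurable function is `ℬ × 𝒴`-measurable away from a null set of times. -/
theorem exists_null_measurable_indicator {E : Type*} [MeasurableSpace E]
    [MeasurableSpace.CountablyGenerated E] [Zero E] {G : ℝ → Y → E}
    (hG : Measurable fun z : LebInterval T × Y => G z.1.val z.2) :
    ∃ N : Set ℝ, volume N = 0 ∧ ∀ I, MeasurableSet I → I ⊆ Icc 0 T \ N →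
      Measurable fun z : ℝ × Y => I.indicator (fun t => G t z.2) z.1 := by
  have hc := MeasurableSpace.countable_countableGeneratingSet (α := E)
  have hex : ∀ c ∈ MeasurableSpace.countableGeneratingSet E, ∃ N : Set ℝ, volume N = 0 ∧
      ∀ I, MeasurableSet I → I ⊆ Icc 0 T \ N →
      MeasurableSet {z : ℝ × Y | z.1 ∈ I ∧ G z.1 z.2 ∈ c} := fun c hc =>
    exists_null_measurableSet_and (p := fun t y => G t y ∈ c)
      (hG (MeasurableSpace.measurableSet_countableGeneratingSet hc))
  choose! N hN h using hex
  -- One null set per generator suffices because the σ-algebra of `E` is countably generated.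
  refine ⟨⋃ c ∈ MeasurableSpace.countableGeneratingSet E, N c,
    (measure_biUnion_null_iff hc).2 hN, fun I hI hIN => ?_⟩
  rw [← MeasurableSpace.generateFrom_countableGeneratingSet (α := E)]
  refine measurable_generateFrom fun c hcE => ?_
  have h1 := h c hcE I hI fun t ht =>
      ⟨(hIN ht).1, fun hc => (hIN ht).2 (mem_biUnion hcE hc)⟩
  convert h1.union ((hI.compl.prod (MeasurableSet.univ (α := Y))).inter
    (MeasurableSet.const ((0 : E) ∈ c))) using 1
  ext ⟨r, y⟩
  by_cases hr : r ∈ I <;> simp [hr]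

end Borelization

/-- Substituting measurable functions in a function which is measurable for a dense sequence of
values of one variable, and continuous in this variable. -/
theorem measurable_of_measurable_dense {Z X E : Type*} [MeasurableSpace Z]
    [PseudoEMetricSpace X] [MeasurableSpace X] [OpensMeasurableSpace X]
    [TopologicalSpace E] [TopologicalSpace.PseudoMetrizableSpace E] [MeasurableSpace E]
    [BorelSpace E] {e : ℕ → X} (he : DenseRange e)
    {h : X → Z → E} (hh : ∀ i, Measurable (h (e i))) {x : Z → X} (hx : Measurable x)
    (hc : ∀ z, ContinuousAt (fun q => h q z) (x z)) : Measurable fun z => h (x z) z := by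
  refine measurable_of_tendsto_metrizable (f := fun N z => h (SimpleFunc.nearestPt e N (x z)) z)
    (fun N => ?_) (tendsto_pi_nhds.2 fun z => ?_)
  · have h1 : Measurable fun z => SimpleFunc.nearestPtInd e N (x z) :=
      (SimpleFunc.nearestPtInd e N).measurable.comp hx
    have h2 : Measurable fun w : ℕ × Z => h (e w.1) w.2 :=
      measurable_from_prod_countable_right fun i => hh i
    exact h2.comp (h1.prodMk measurable_id)
  · exact (hc z).tendsto.comp (SimpleFunc.tendsto_nearestPt (he (x z)))

theorem measurable_indicator_of_restrict {Z E : Type*} [MeasurableSpace Z] [MeasurableSpace E]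
    [Zero E] {s : Set Z} (hs : MeasurableSet s) {G : Z → E} (h : Measurable fun z : s => G z) :
    Measurable (s.indicator G) := by
  refine measurable_of_restrict_of_restrict_compl hs ?_ ?_
  · convert h using 1
    ext z
    simp
  · convert measurable_const (a := (0 : E)) using 1
    ext z
    simp [indicator_of_notMem z.2]

theorem aestronglyMeasurable_restrict_of_ae_mem {E : Type*} [NormedAddCommGroup E]
    [MeasurableSpace E] [BorelSpace E] [SecondCountableTopology E] {s I : Set ℝ}
    (hI : MeasurableSet I) (hsI : ∀ᵐ t ∂(volume.restrict s), t ∈ I) {G : ℝ → E}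
    (h : Measurable fun t : I => G t) : AEStronglyMeasurable G (volume.restrict s) :=
  (measurable_indicator_of_restrict hI h).aestronglyMeasurable.congr
    (hsI.mono fun _ ht => indicator_of_mem ht G)

/-! ### Regular times, measurable substitution and the integral form of the dynamics. -/

namespace AverageProblem

variable {n m : ℕ} {Ω : Type*}

/-- A Borel set `I` of full measure of times at which the pointwise hypotheses on the dynamics hold,
and on which the data are Borel measurable. -/
structure RegularTimes [MeasurableSpace Ω] (P : AverageProblem n m Ω) (ubar : ℝ → Euc m)
    (xbar : ℝ → Ω → Euc n) (δ c : ℝ) (k : ℝ → ℝ) (I : Set ℝ) : Prop where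
  measurableSet : MeasurableSet I
  subset : I ⊆ Icc 0 P.T
  ae_mem : ∀ᵐ t ∂(volume.restrict (Icc 0 P.T)), t ∈ I
  integrableOn : IntegrableOn k (Icc 0 P.T)
  nonneg : ∀ t, 0 ≤ k t
  graph : MeasurableSet {z : ℝ × Euc m | z.1 ∈ I ∧ z.2 ∈ P.U z.1}
  measurable_f : ∀ i, Measurable fun z : ℝ × Euc m × Ω =>
    I.indicator (fun t => P.f t (TopologicalSpace.denseSeq (Euc n) i) z.2.1 z.2.2) z.1
  measurable_ubar : Measurable (I.indicator ubar)
  ubar_mem : ∀ t ∈ I, ubar t ∈ P.U t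
  bound : ∀ t ∈ I, ∀ ω, ∀ u ∈ P.U t, ∀ x ∈ Metric.closedBall (xbar t ω) δ, ‖P.f t x u ω‖ ≤ c
  lip : ∀ t ∈ I, ∀ ω, ∀ u ∈ P.U t, ∀ x ∈ Metric.closedBall (xbar t ω) δ,
    ∀ x' ∈ Metric.closedBall (xbar t ω) δ, ‖P.f t x u ω - P.f t x' u ω‖ ≤ k t * ‖x - x'‖
  differentiableAt : ∀ t ∈ I, ∀ ω, ∀ u ∈ P.U t, ∀ x ∈ Metric.closedBall (xbar t ω) δ,
    DifferentiableAt ℝ (fun y => P.f t y u ω) x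
  continuousOn_gradF : ∀ t ∈ I, ∀ ω, ∀ u ∈ P.U t,
    ContinuousOn (fun x => P.gradF t x u ω) (Metric.closedBall (xbar t ω) δ)

theorem exists_regularTimes [PseudoMetricSpace Ω] [MeasurableSpace Ω] {P : AverageProblem n m Ω}
    {ubar : ℝ → Euc m} {xbar : ℝ → Ω → Euc n} {δ : ℝ} (hu : P.IsControl ubar)
    (hmeas : P.MeasurableData xbar δ) (hdyn : P.LipschitzBoundedDynamics xbar δ)
    (hf : P.SmoothDynamics xbar δ) :
    ∃ c > 0, ∃ k I, P.RegularTimes ubar xbar δ c k I := by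
  obtain ⟨c, hc, k, hk, hdyn⟩ := hdyn
  choose Nf hNf hNf' using fun i =>
    exists_null_measurable_indicator (T := P.T) (Y := Euc m × Ω)
      (G := fun t z => P.f t (TopologicalSpace.denseSeq (Euc n) i) z.1 z.2) (hmeas.measurable_f _)
  obtain ⟨NU, hNU, hNU'⟩ := exists_null_measurableSet_and (T := P.T) (Y := Euc m)
    (p := fun t u => u ∈ P.U t) hmeas.measurable_graph_U
  obtain ⟨Nu, hNu, hNu'⟩ := exists_null_measurable_indicator (T := P.T) (Y := Unit)
    (G := fun t _ => ubar t) (hu.1.comp measurable_fst)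
  have hall := hdyn.and (hf.1.and hu.2)
  rw [ae_restrict_iff' measurableSet_Icc] at hall
  obtain ⟨G, hG, hgood⟩ := hall.exists_mem
  -- All exceptional times are absorbed in one Borel null set. The Lipschitz rate is replaced below
  -- by `max (k t) 0`, to be nonnegative at every time.
  set M := toMeasurable volume (Gᶜ ∪ ((⋃ i, Nf i) ∪ (NU ∪ Nu))) with hM
  have hM0 : volume M = 0 := by
    rw [hM, measure_toMeasurable]
    exact measure_union_null (mem_ae_iff.1 hG) (measure_union_null (measure_iUnion_null hNf)
      (measure_union_null hNU hNu))
  have hsub : Gᶜ ∪ ((⋃ i, Nf i) ∪ (NU ∪ Nu)) ⊆ M := subset_toMeasurable volume _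
  have hI : MeasurableSet (Icc 0 P.T \ M) := measurableSet_Icc.diff (measurableSet_toMeasurable _ _)
  replace hgood := fun t (ht : t ∈ Icc 0 P.T \ M) =>
    hgood t (not_not.1 fun h => ht.2 (hsub (Or.inl h))) ht.1
  refine ⟨c, hc, fun t => max (k t) 0, Icc 0 P.T \ M, hI, sdiff_subset, ?_, hk.sup (integrable_zero _ _ _),
    fun t => le_max_right _ _, ?_, fun i => ?_, ?_, fun t ht => (hgood t ht).2.2,
    fun t ht ω u hu x hx => ((hgood t ht).1 ω u hu x hx).1, fun t ht ω u hu x hx x' hx' =>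
    (((hgood t ht).1 ω u hu x hx).2 x' hx').trans
      (mul_le_mul_of_nonneg_right (le_max_left _ _) (norm_nonneg _)),
    fun t ht ω u hu x hx => ((hgood t ht).2.1 ω u hu).1 x hx,
    fun t ht ω u hu => ((hgood t ht).2.1 ω u hu).2⟩
  · have : ∀ᵐ t, t ∉ M := measure_eq_zero_iff_ae_notMem.1 hM0
    filter_upwards [ae_restrict_mem measurableSet_Icc, ae_restrict_of_ae this] with t h1 h2
    exact ⟨h1, h2⟩
  · exact hNU' _ hI fun t ht => ⟨ht.1, fun h => ht.2 (hsub (Or.inr (Or.inr (Or.inl h))))⟩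
  · exact hNf' i _ hI fun t ht =>
      ⟨ht.1, fun h => ht.2 (hsub (Or.inr (Or.inl (mem_iUnion_of_mem i h))))⟩
  · exact (hNu' _ hI fun t ht => ⟨ht.1, fun h => ht.2 (hsub (Or.inr (Or.inr (Or.inr h))))⟩).comp
      (measurable_id.prodMk (measurable_const (a := ())))

namespace RegularTimes

variable [MeasurableSpace Ω] {P : AverageProblem n m Ω} {ubar : ℝ → Euc m} {xbar : ℝ → Ω → Euc n}
  {δ c : ℝ} {k : ℝ → ℝ} {I : Set ℝ}

/-- Measurability of `f` is known only for frozen `x`, so `x z` is approximated from a dense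
sequence. The approximants may leave the tube, hence full continuity at `x z` is required; it comes
from differentiability there, not from the Lipschitz bound on the tube. -/
theorem measurable_comp (R : P.RegularTimes ubar xbar δ c k I) {Z : Type*} [MeasurableSpace Z]
    {τ : Z → ℝ} {w : Z → Euc m} {o : Z → Ω} {x : Z → Euc n} (hτ : Measurable τ) (hw : Measurable w)
    (ho : Measurable o) (hx : Measurable x) (hτI : ∀ z, τ z ∈ I) (hwU : ∀ z, w z ∈ P.U (τ z))
    (hxδ : ∀ z, x z ∈ Metric.closedBall (xbar (τ z) (o z)) δ) :
    Measurable fun z => P.f (τ z) (x z) (w z) (o z) := by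
  refine measurable_of_measurable_dense (h := fun q z => P.f (τ z) q (w z) (o z))
    (TopologicalSpace.denseRange_denseSeq (Euc n)) (fun i => ?_) hx
    fun z => (R.differentiableAt _ (hτI z) _ _ (hwU z) _ (hxδ z)).continuousAt
  convert (R.measurable_f i).comp (hτ.prodMk (hw.prodMk ho)) using 1
  ext1 z
  simp [indicator_of_mem (hτI z)]

theorem measurable_ubar_coe (R : P.RegularTimes ubar xbar δ c k I) :
    Measurable fun t : I => ubar t := by
  convert R.measurable_ubar.comp measurable_subtype_coe using 1
  ext1 t
  simp

theorem integrableOn_of_measurable (R : P.RegularTimes ubar xbar δ c k I) {w : ℝ → Euc m}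
    (hw : Measurable fun t : I => w t) (hwU : ∀ t ∈ I, w t ∈ P.U t) (ω : Ω) {y : ℝ → Euc n}
    (hy : ContinuousOn y (Icc 0 P.T))
    (hyδ : ∀ t ∈ Icc 0 P.T, y t ∈ Metric.closedBall (xbar t ω) δ) :
    IntegrableOn (fun t => P.f t (y t) (w t) ω) (Icc 0 P.T) := by
  refine IntegrableOn.of_bound (C := c) (by simp) ?_ ?_
  · refine aestronglyMeasurable_restrict_of_ae_mem R.measurableSet R.ae_mem ?_
    exact R.measurable_comp measurable_subtype_coe hw measurable_const
      (hy.mono R.subset).domRestrict.measurable (fun t => t.2) (fun t => hwU t t.2)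
      fun t => hyδ t (R.subset t.2)
  · filter_upwards [R.ae_mem] with t ht
    exact R.bound t ht ω _ (hwU t ht) _ (hyδ t (R.subset ht))

theorem norm_gradF_le (R : P.RegularTimes ubar xbar δ c k I) {t : ℝ} (ht : t ∈ I)
    {ω : Ω} {u : Euc m} (hu : u ∈ P.U t) {x : Euc n} (hx : x ∈ Metric.ball (xbar t ω) δ) :
    ‖P.gradF t x u ω‖ ≤ k t := by
  refine (R.differentiableAt t ht ω u hu x (Metric.ball_subset_closedBall hx)).hasFDerivAt.le_of_lip'
    (R.nonneg t) ?_
  filter_upwards [Metric.isOpen_ball.mem_nhds hx] with x' hx'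
  exact R.lip t ht ω u hu _ (Metric.ball_subset_closedBall hx') _ (Metric.ball_subset_closedBall hx)

end RegularTimes

end AverageProblem

/-- A curve which is the integral of an integrable function is absolutely continuous, with the
expected derivative. -/
theorem isW11_of_eq_integral {n : ℕ} {T : ℝ} (hT : 0 ≤ T) {F y : ℝ → Euc n} {y₀ : Euc n}
    (hF : IntegrableOn F (Icc 0 T)) (hy : ∀ t ∈ Icc 0 T, y t = y₀ + ∫ s in (0 : ℝ)..t, F s) :
    IsW11 T y ∧ ∀ᵐ t ∂(volume.restrict (Icc 0 T)), HasDerivAt y (F t) t := by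
  have hi := hF.intervalIntegrable_of_mem (s := 0) (t := T) ⟨le_rfl, hT⟩ ⟨hT, le_rfl⟩
  have hac := absolutelyContinuousOnInterval_integral hT hi
  constructor
  · refine hac.of_dist_le hac 1 fun s hs t ht => ?_
    rw [uIcc_of_le hT] at hs ht
    rw [hy s hs, hy t ht, dist_add_left, one_mul]
    exact le_add_of_nonneg_right dist_nonneg
  -- The integral formula says nothing about `y` outside `[0,T]`, so two-sided derivatives are
  -- claimed only at interior times.
  · have h0 : ∀ᵐ t : ℝ, t ≠ 0 ∧ t ≠ T := (by simp [ae_iff] : ∀ᵐ t : ℝ, t ≠ 0).and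
      (by simp [ae_iff] : ∀ᵐ t : ℝ, t ≠ T)
    rw [ae_restrict_iff' measurableSet_Icc]
    filter_upwards [h0, hi.ae_hasDerivAt_integral] with t ht hd htI
    rw [uIcc_of_le hT] at hd
    refine ((hd htI 0 ⟨le_rfl, hT⟩).const_add y₀).congr_of_eventuallyEq ?_
    filter_upwards [Icc_mem_nhds (lt_of_le_of_ne htI.1 ht.1.symm) (lt_of_le_of_ne htI.2 ht.2)]
      with s hs using hy s hs

namespace AverageProblem

variable {n m : ℕ} {Ω : Type*} {P : AverageProblem n m Ω} {w : ℝ → Euc m} {y : ℝ → Ω → Euc n}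

theorem IsControlledPair.continuousOn (hy : P.IsControlledPair w y) (ω : Ω) :
    ContinuousOn (fun t => y t ω) (Icc 0 P.T) := by
  have := (hy.2 ω).1.continuousOn
  rwa [uIcc_of_le P.T_pos.le] at this

variable [MeasurableSpace Ω] {ubar : ℝ → Euc m} {xbar : ℝ → Ω → Euc n} {δ c : ℝ} {k : ℝ → ℝ}
  {I : Set ℝ}

theorem IsControlledPair.integrableOn (hy : P.IsControlledPair w y)
    (R : P.RegularTimes ubar xbar δ c k I) (ω : Ω)
    (hyδ : ∀ t ∈ Icc 0 P.T, y t ω ∈ Metric.closedBall (xbar t ω) δ) :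
    IntegrableOn (fun t => P.f t (y t ω) (w t) ω) (Icc 0 P.T) := by
  refine IntegrableOn.of_bound (C := c) (by simp) ?_ ?_
  -- The integrand equals `deriv` of the arc almost everywhere, which gives its measurability
  -- without a substitution argument.
  · refine (aestronglyMeasurable_deriv (fun t => y t ω) _).congr ?_
    filter_upwards [(hy.2 ω).2.2] with t ht using ht.deriv
  · filter_upwards [R.ae_mem, hy.1.2] with t ht hw
    exact R.bound t ht ω _ hw _ (hyδ t (R.subset ht))

theorem IsControlledPair.eq_integral (hy : P.IsControlledPair w y)
    (R : P.RegularTimes ubar xbar δ c k I) (ω : Ω)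
    (hyδ : ∀ t ∈ Icc 0 P.T, y t ω ∈ Metric.closedBall (xbar t ω) δ) {t : ℝ} (ht : t ∈ Icc 0 P.T) :
    y t ω = P.x₀ + ∫ s in (0 : ℝ)..t, P.f s (y s ω) (w s) ω := by
  have := (hy.2 ω).1.eq_add_integral P.T_pos.le (hy.2 ω).2.2
    ((hy.integrableOn R ω hyδ).intervalIntegrable_of_mem ⟨le_rfl, P.T_pos.le⟩ ⟨P.T_pos.le, le_rfl⟩)
    ht
  rwa [(hy.2 ω).2.1] at this

end AverageProblem

namespace AverageProblem

variable {n m : ℕ} {Ω : Type*} {P : AverageProblem n m Ω} {w : ℝ → Euc m} {y : ℝ → Ω → Euc n}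
  {ubar : ℝ → Euc m} {xbar : ℝ → Ω → Euc n} {δ c : ℝ} {k : ℝ → ℝ} {I : Set ℝ}

/-! ### Continuous dependence of the arcs on the parameter. -/

section Continuity

variable [MeasurableSpace Ω]

/-- Comparison of the arcs of a process for two parameters. -/
theorem IsControlledPair.norm_sub_le (hy : P.IsControlledPair w y)
    (R : P.RegularTimes ubar xbar δ c k I)
    (hyδ : ∀ ω, ∀ t ∈ Icc 0 P.T, y t ω ∈ Metric.closedBall (xbar t ω) (δ / 2)) (hδ : 0 < δ)
    {θ : ℝ≥0} {ω ω' : Ω}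
    (hθ : ∫⁻ t in Icc 0 P.T, ⨆ x ∈ Metric.closedBall (xbar t ω) δ, ⨆ u ∈ P.U t,
      ‖P.f t x u ω - P.f t x u ω'‖ₑ ≤ θ) (hθδ : 2 * θ * expWeight k P.T < δ / 2)
    {t : ℝ} (ht : t ∈ Icc 0 P.T) : ‖y t ω - y t ω'‖ ≤ 2 * θ * expWeight k t := by
  have hyδ' : ∀ ω, ∀ t ∈ Icc 0 P.T, y t ω ∈ Metric.closedBall (xbar t ω) δ := fun ω t ht =>
    Metric.closedBall_subset_closedBall (half_le_self hδ.le) (hyδ ω t ht)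
  have hc : ContinuousOn (fun t => ‖y t ω - y t ω'‖) (Icc 0 P.T) :=
    ((hy.continuousOn ω).sub (hy.continuousOn ω')).norm
  refine le_mul_expWeight_of_le_integral_of_le R.integrableOn R.nonneg hc θ.coe_nonneg hθδ
    (fun t ht hr => ?_) ?_ ht
  · have h0T : (0 : ℝ) ∈ Icc 0 P.T := ⟨le_rfl, P.T_pos.le⟩
    set F : ℝ → Euc n := fun s => P.f s (y s ω) (w s) ω - P.f s (y s ω') (w s) ω' with hF
    have hFi : IntegrableOn F (Icc 0 P.T) :=
      (hy.integrableOn R ω (hyδ' ω)).sub (hy.integrableOn R ω' (hyδ' ω'))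
    have hkD : IntegrableOn (fun s => k s * ‖y s ω - y s ω'‖) (Icc 0 P.T) :=
      R.integrableOn.mul_continuousOn hc isCompact_Icc
    -- The supremum in the modulus hypothesis need not be measurable. This positive part is
    -- integrable and lies below it, so the comparison needs only monotonicity of the lower
    -- integral.
    have hh : IntegrableOn (fun s => max (‖F s‖ - k s * ‖y s ω - y s ω'‖) 0) (Icc 0 P.T) :=
      (hFi.norm.sub hkD).sup (integrable_zero _ _ _)
    rw [hy.eq_integral R ω (hyδ' ω) ht, hy.eq_integral R ω' (hyδ' ω') ht, add_sub_add_left_eq_sub,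
      ← intervalIntegral.integral_sub
        ((hy.integrableOn R ω (hyδ' ω)).intervalIntegrable_of_mem h0T ht)
        ((hy.integrableOn R ω' (hyδ' ω')).intervalIntegrable_of_mem h0T ht)]
    have h1 : ‖∫ s in (0 : ℝ)..t, F s‖ ≤ ∫ s in (0 : ℝ)..t,
        (max (‖F s‖ - k s * ‖y s ω - y s ω'‖) 0 + k s * ‖y s ω - y s ω'‖) := by
      refine intervalIntegral.norm_integral_le_of_norm_le ht.1
        (Eventually.of_forall fun s _ => ?_)
        ((hh.intervalIntegrable_of_mem h0T ht).add (hkD.intervalIntegrable_of_mem h0T ht))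
      linarith [le_max_left (‖F s‖ - k s * ‖y s ω - y s ω'‖) 0]
    rw [intervalIntegral.integral_add (hh.intervalIntegrable_of_mem h0T ht)
      (hkD.intervalIntegrable_of_mem h0T ht)] at h1
    refine h1.trans (add_le_add ?_ le_rfl)
    have hsub : Ioc 0 t ⊆ Icc 0 P.T := fun s hs => ⟨hs.1.le, hs.2.trans ht.2⟩
    rw [intervalIntegral.integral_of_le ht.1, integral_eq_lintegral_of_nonneg_ae
      (Eventually.of_forall fun s => le_max_right (‖F s‖ - k s * ‖y s ω - y s ω'‖) 0)
      (hh.mono_set hsub).aestronglyMeasurable]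
    refine ENNReal.toReal_le_of_le_ofReal θ.coe_nonneg ?_
    rw [ENNReal.ofReal_coe_nnreal]
    refine le_trans ?_ hθ
    refine (lintegral_mono_ae ?_).trans
      (lintegral_mono_set hsub)
    filter_upwards [ae_restrict_of_ae_restrict_of_subset hsub (R.ae_mem.and hy.1.2),
      ae_restrict_mem measurableSet_Ioc] with s hs hst
    have hsT := R.subset hs.1
    refine le_trans ?_ (le_iSup₂_of_le (y s ω) (hyδ' ω s hsT) (le_iSup₂_of_le (w s) hs.2 le_rfl))
    rw [← ofReal_norm]
    refine ENNReal.ofReal_le_ofReal (max_le ?_ (norm_nonneg _))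
    -- The Lipschitz bound for `ω'` is needed at the arc of `ω`. The two halves of `δ` come from the
    -- tube around `xbar s ω'` and from the a priori bound `hr`; this is why the bootstrapped
    -- Gronwall inequality is used.
    have hyω : y s ω ∈ Metric.closedBall (xbar s ω') δ := by
      have h2 := hyδ ω' s hsT
      have h3 := hr s ⟨hst.1.le, hst.2⟩
      rw [mem_closedBall_iff_norm] at h2 ⊢
      calc _ = ‖(y s ω - y s ω') + (y s ω' - xbar s ω')‖ := by congr 1; abel
        _ ≤ _ := norm_add_le _ _
        _ ≤ δ := by linarith
    have h4 := R.lip s hs.1 ω' (w s) hs.2 _ hyω _ (hyδ' ω' s hsT)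
    have h5 : F s = (P.f s (y s ω) (w s) ω - P.f s (y s ω) (w s) ω')
        + (P.f s (y s ω) (w s) ω' - P.f s (y s ω') (w s) ω') := by simp only [hF]; abel
    have h6 := norm_add_le (P.f s (y s ω) (w s) ω - P.f s (y s ω) (w s) ω')
      (P.f s (y s ω) (w s) ω' - P.f s (y s ω') (w s) ω')
    rw [← h5] at h6
    linarith
  · simp only [(hy.2 ω).2.1, (hy.2 ω').2.1, sub_self, norm_zero]; linarith

/-- The arcs of a process near the reference one depend continuously on the parameter. -/
theorem IsControlledPair.continuous [PseudoMetricSpace Ω] (hy : P.IsControlledPair w y)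
    (R : P.RegularTimes ubar xbar δ c k I) (hparam : P.ParameterModulus xbar δ)
    (hyδ : ∀ ω, ∀ t ∈ Icc 0 P.T, y t ω ∈ Metric.closedBall (xbar t ω) (δ / 2)) (hδ : 0 < δ)
    {t : ℝ} (ht : t ∈ Icc 0 P.T) : Continuous (y t) := by
  obtain ⟨θ, hθ, hθb⟩ := hparam
  rw [Metric.continuous_iff']
  intro ω ε hε
  have hlim : Tendsto (fun s => 2 * (θ s : ℝ) * expWeight k P.T) (𝓝[>] 0) (𝓝 0) := by
    have := ((NNReal.tendsto_coe.2 hθ.2).const_mul 2).mul_const (expWeight k P.T)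
    simpa using this
  obtain ⟨η, hη, hη'⟩ := mem_nhdsGT_iff_exists_Ioo_subset.1
    (hlim.eventually (gt_mem_nhds (lt_min (half_pos hδ) hε)))
  filter_upwards [Metric.ball_mem_nhds ω (show (0 : ℝ) < η from hη)] with ω' hω'
  have hd : nndist ω ω' < η := by
    rw [Metric.mem_ball, dist_comm] at hω'; exact_mod_cast hω'
  have key : ∀ s ∈ Ioo 0 η, nndist ω ω' ≤ s → dist (y t ω') (y t ω) < ε := fun s hs hds => by
    have h1 : 2 * (θ s : ℝ) * expWeight k P.T < min (δ / 2) ε := hη' hs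
    have h2 := hy.norm_sub_le R hyδ hδ (θ := θ s)
      ((hθb ω ω ω').trans (by exact_mod_cast hθ.1 hds)) (h1.trans_le (min_le_left _ _)) ht
    have h3 := expWeight_mono R.integrableOn R.nonneg ht.1 ht.2 le_rfl
    rw [dist_comm, dist_eq_norm]
    have h4 : 0 ≤ 2 * (θ s : ℝ) := by positivity
    exact (h2.trans (mul_le_mul_of_nonneg_left h3 h4)).trans_lt (h1.trans_le (min_le_right _ _))
  -- The modulus is controlled only at positive arguments, whereas the distance may be zero; a
  -- slightly larger `s` and monotonicity avoid evaluating it at `0`.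
  obtain ⟨s, hs1, hs2⟩ := exists_between hd
  exact key s ⟨lt_of_le_of_lt (zero_le (a := nndist ω ω')) hs1, hs2⟩ hs1.le

end Continuity

/-! ### Processes with the control changed on a small set. -/

section Perturbation

theorem integral_indicator_const_le {A : Set ℝ} (hA : MeasurableSet A) {T b : ℝ} (hb : 0 ≤ b)
    (hAT : A ⊆ Icc 0 T) {t : ℝ} (ht : t ∈ Icc 0 T) :
    ∫ s in (0 : ℝ)..t, A.indicator (fun _ => b) s ≤ b * volume.real A := by
  rw [intervalIntegral.integral_of_le ht.1, setIntegral_indicator hA, setIntegral_const,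
    smul_eq_mul, mul_comm]
  have hfin : volume A ≠ ∞ := ((measure_mono hAT).trans_lt (by simp)).ne
  exact mul_le_mul_of_nonneg_left (measureReal_mono inter_subset_right hfin) hb

theorem integrableOn_indicator_const {A : Set ℝ} (hA : MeasurableSet A) (T b : ℝ) :
    IntegrableOn (A.indicator fun _ => b) (Icc 0 T) :=
  (integrableOn_const (by simp)).indicator hA

variable [MeasurableSpace Ω]

open Classical in
theorem RegularTimes.piecewise_mem (R : P.RegularTimes ubar xbar δ c k I) {A : Set ℝ}
    {v : ℝ → Euc m} (hvU : ∀ t ∈ A, v t ∈ P.U t) : ∀ t ∈ I, A.piecewise v ubar t ∈ P.U t :=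
  fun t ht => by
    by_cases h : t ∈ A
    · simpa [h] using hvU t h
    · simpa [h] using R.ubar_mem t ht

open Classical in
theorem RegularTimes.measurable_piecewise_coe (R : P.RegularTimes ubar xbar δ c k I) {A : Set ℝ}
    (hA : MeasurableSet A) {v : ℝ → Euc m} (hv : Measurable v) :
    Measurable fun t : I => A.piecewise v ubar t := by
  have h1 : Measurable ((Subtype.val ⁻¹' A : Set I).piecewise (fun t : I => v t)
    fun t : I => ubar t) := Measurable.piecewise (measurable_subtype_coe hA)
      (hv.comp measurable_subtype_coe) R.measurable_ubar_coe
  exact h1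

open Classical in
/-- Existence of the process obtained by changing the control on a small set of times. -/
theorem RegularTimes.exists_isControlledPair_piecewise (R : P.RegularTimes ubar xbar δ c k I)
    (hx : P.IsControlledPair ubar xbar) (hδ : 0 < δ) (hc : 0 < c) {A : Set ℝ}
    (hA : MeasurableSet A) (hAI : A ⊆ I) {v : ℝ → Euc m} (hv : Measurable v)
    (hvU : ∀ t ∈ A, v t ∈ P.U t) (hsmall : 4 * c * volume.real A * expWeight k P.T ≤ δ / 2) :
    ∃ y : ℝ → Ω → Euc n, P.IsControlledPair (A.piecewise v ubar) y ∧
      ∀ ω, ∀ t ∈ Icc 0 P.T, ‖y t ω - xbar t ω‖ ≤ 4 * c * volume.real A * expWeight k P.T := by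
  have h0T : (0 : ℝ) ∈ Icc 0 P.T := ⟨le_rfl, P.T_pos.le⟩
  have hwU := R.piecewise_mem hvU
  have hw := R.measurable_piecewise_coe hA hv
  have hwc : P.IsControl (A.piecewise v ubar) := by
    refine ⟨?_, R.ae_mem.mono hwU⟩
    have h1 : Measurable ((LebInterval.val ⁻¹' A : Set (LebInterval P.T)).piecewise
      (fun t : LebInterval P.T => v t.val) fun t : LebInterval P.T => ubar t.val) :=
      Measurable.piecewise (measurable_lebInterval_val hA)
        (hv.comp measurable_lebInterval_val) hx.1.1
    exact h1
  have hball : ∀ {ω t x}, x ∈ Metric.closedBall (xbar t ω) (δ / 2) →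
      x ∈ Metric.closedBall (xbar t ω) δ := fun h =>
    Metric.closedBall_subset_closedBall (half_le_self hδ.le) h
  have hself : ∀ ω, ∀ t ∈ Icc 0 P.T, xbar t ω ∈ Metric.closedBall (xbar t ω) δ := fun ω t _ =>
    Metric.mem_closedBall_self hδ.le
  have hex : ∀ ω, ∃ y : ℝ → Euc n, ContinuousOn y (Icc 0 P.T) ∧
      (∀ t ∈ Icc 0 P.T, y t = P.x₀ + ∫ s in (0 : ℝ)..t, P.f s (y s) (A.piecewise v ubar s) ω) ∧
      ∀ t ∈ Icc 0 P.T, ‖y t - xbar t ω‖ ≤ 2 * (2 * c * volume.real A) * expWeight k t := by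
    intro ω
    refine exists_integral_curve_near R.integrableOn R.nonneg
      (F := fun s x => P.f s x (A.piecewise v ubar s) ω) (hx.continuousOn ω) P.x₀ (r := δ / 2)
      (fun y hy hyδ => R.integrableOn_of_measurable hw hwU ω hy fun t ht => hball (hyδ t ht))
      ?_ (fun t ht => ?_) (by positivity) (by linarith)
    · filter_upwards [R.ae_mem] with t ht x hx x' hx'
      exact R.lip t ht ω _ (hwU t ht) x (hball hx) x' (hball hx')
    · have hi := R.integrableOn_of_measurable hw hwU ω (hx.continuousOn ω) (hself ω)
      have hi' := hx.integrableOn R ω (hself ω)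
      rw [hx.eq_integral R ω (hself ω) ht, add_sub_add_left_eq_sub,
        ← intervalIntegral.integral_sub (hi.intervalIntegrable_of_mem h0T ht)
          (hi'.intervalIntegrable_of_mem h0T ht)]
      -- Along the reference arc the two velocities differ only on `A`, by at most `2 * c`. The
      -- residual is thus at most `2 * c * |A|`, and Picard iteration doubles it.
      refine le_trans (intervalIntegral.norm_integral_le_of_norm_le ht.1 ?_
        ((integrableOn_indicator_const hA P.T (2 * c)).intervalIntegrable_of_mem h0T ht))
        (integral_indicator_const_le hA (by positivity) (hAI.trans R.subset) ht)
      have hI := R.ae_mem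
      rw [ae_restrict_iff' measurableSet_Icc] at hI
      filter_upwards [hI] with s hs hst
      have hsI := hs ⟨hst.1.le, hst.2.trans ht.2⟩
      by_cases hsA : s ∈ A
      · have h1 := R.bound s hsI ω _ (hwU s hsI) _ (hself ω s (R.subset hsI))
        have h2 := R.bound s hsI ω _ (R.ubar_mem s hsI) _ (hself ω s (R.subset hsI))
        rw [indicator_of_mem hsA]
        exact (_root_.norm_sub_le _ _).trans (by linarith)
      · simp [hsA]
  choose y hyc hy hyx using hex
  refine ⟨fun t ω => y ω t, ⟨hwc, fun ω => ?_⟩, fun ω t ht => ?_⟩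
  · have hyδ : ∀ t ∈ Icc 0 P.T, y ω t ∈ Metric.closedBall (xbar t ω) δ := fun t ht => by
      refine hball (mem_closedBall_iff_norm.2 ((hyx ω t ht).trans (le_trans ?_ hsmall)))
      have := expWeight_mono R.integrableOn R.nonneg ht.1 ht.2 le_rfl
      have h2 : 0 ≤ 4 * c * volume.real A := by positivity
      nlinarith
    obtain ⟨h1, h2⟩ := isW11_of_eq_integral P.T_pos.le
      (R.integrableOn_of_measurable hw hwU ω (hyc ω) hyδ) (hy ω)
    exact ⟨h1, by simpa using hy ω 0 h0T, h2⟩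
  · refine (hyx ω t ht).trans ?_
    have := expWeight_mono R.integrableOn R.nonneg ht.1 ht.2 le_rfl
    have h2 : 0 ≤ 4 * c * volume.real A := by positivity
    nlinarith

-- On `A` the velocities differ by at most `2 * c`; off `A` the controls agree and the Lipschitz
-- rate applies. Thus a small change set gives closeness in the norm of the local minimality
-- condition, uniformly in `ω`.
open Classical in
theorem RegularTimes.normW11_sub_le (R : P.RegularTimes ubar xbar δ c k I)
    (hx : P.IsControlledPair ubar xbar) (hδ : 0 < δ) (hc : 0 < c) {A : Set ℝ}
    (hA : MeasurableSet A) (hAI : A ⊆ I) {v : ℝ → Euc m}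
    (hvU : ∀ t ∈ A, v t ∈ P.U t) (hy : P.IsControlledPair (A.piecewise v ubar) y) {b : ℝ}
    (hb : b ≤ δ) {ω : Ω} (hyx : ∀ t ∈ Icc 0 P.T, ‖y t ω - xbar t ω‖ ≤ b) :
    normW11 P.T (fun t => xbar t ω - y t ω)
      ≤ 2 * c * volume.real A + b * ∫ s in (0 : ℝ)..P.T, k s := by
  have h0T : (0 : ℝ) ∈ Icc 0 P.T := ⟨le_rfl, P.T_pos.le⟩
  have hTT : P.T ∈ Icc 0 P.T := ⟨P.T_pos.le, le_rfl⟩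
  have hself : ∀ ω, ∀ t ∈ Icc 0 P.T, xbar t ω ∈ Metric.closedBall (xbar t ω) δ := fun ω t _ =>
    Metric.mem_closedBall_self hδ.le
  have hyδ : ∀ t ∈ Icc 0 P.T, y t ω ∈ Metric.closedBall (xbar t ω) δ := fun t ht =>
    mem_closedBall_iff_norm.2 ((hyx t ht).trans hb)
  have hb0 : 0 ≤ b := (norm_nonneg _).trans (hyx 0 h0T)
  have hi := (integrableOn_indicator_const hA P.T (2 * c)).intervalIntegrable_of_mem h0T hTT
  have hk := (R.integrableOn.intervalIntegrable_of_mem h0T hTT).const_mul b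
  rw [normW11, (hx.2 ω).2.1, (hy.2 ω).2.1, sub_self, norm_zero, zero_add]
  calc _ ≤ ∫ s in (0 : ℝ)..P.T, (A.indicator (fun _ => 2 * c) s + b * k s) := by
        refine (le_abs_self _).trans ?_
        rw [← Real.norm_eq_abs]
        refine intervalIntegral.norm_integral_le_of_norm_le P.T_pos.le ?_ (hi.add hk)
        have hall := R.ae_mem.and ((hx.2 ω).2.2.and (hy.2 ω).2.2)
        rw [ae_restrict_iff' measurableSet_Icc] at hall
        filter_upwards [hall] with s hs hst
        obtain ⟨hsI, h1, h2⟩ := hs ⟨hst.1.le, hst.2⟩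
        have hsT := R.subset hsI
        rw [norm_norm, (h1.fun_sub h2).deriv]
        have h3 := mul_le_mul_of_nonneg_left (hyx s hsT) (R.nonneg s)
        by_cases hsA : s ∈ A
        · rw [indicator_of_mem hsA, piecewise_eq_of_mem _ _ _ hsA]
          have h4 := R.bound s hsI ω _ (hvU s hsA) _ (hyδ s hsT)
          have h5 := R.bound s hsI ω _ (R.ubar_mem s hsI) _ (hself ω s hsT)
          have h6 := mul_nonneg hb0 (R.nonneg s)
          exact (_root_.norm_sub_le _ _).trans (by linarith)
        · rw [indicator_of_notMem hsA, piecewise_eq_of_notMem _ _ _ hsA, norm_sub_rev]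
          have h4 := R.lip s hsI ω _ (R.ubar_mem s hsI) _ (hyδ s hsT) _ (hself ω s hsT)
          linarith
    _ ≤ _ := by
        rw [intervalIntegral.integral_add hi hk, intervalIntegral.integral_const_mul]
        gcongr
        exact integral_indicator_const_le hA (by positivity) (hAI.trans R.subset) hTT

end Perturbation

end AverageProblem

/-! ### Linear equations with a terminal condition. -/

section Backward

variable {E : Type*} [NormedAddCommGroup E] {T : ℝ} {k : ℝ → ℝ}

theorem measurePreserving_sub_left_restrict_Icc (T : ℝ) :
    MeasurePreserving (fun s => T - s) (volume.restrict (Icc 0 T)) (volume.restrict (Icc 0 T)) := by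
  have := (Measure.measurePreserving_sub_left volume T).restrict_preimage (s := Icc 0 T) measurableSet_Icc
  simpa using this

theorem expWeight_comp_sub_left (T : ℝ) (k : ℝ → ℝ) :
    expWeight (fun s => k (T - s)) T = expWeight k T := by
  simp [expWeight, intervalIntegral.integral_comp_sub_left]

theorem MeasureTheory.IntegrableOn.comp_sub_left_Icc {F : ℝ → E} (hF : IntegrableOn F (Icc 0 T)) :
    IntegrableOn (fun s => F (T - s)) (Icc 0 T) :=
  (measurePreserving_sub_left_restrict_Icc T).integrable_comp_of_integrable hF

theorem sub_mem_Icc_zero {t : ℝ} (ht : t ∈ Icc 0 T) : T - t ∈ Icc 0 T :=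
  ⟨sub_nonneg.2 ht.2, sub_le_self T ht.1⟩

theorem ContinuousOn.comp_sub_left_Icc {F : ℝ → E} (hF : ContinuousOn F (Icc 0 T)) :
    ContinuousOn (fun s => F (T - s)) (Icc 0 T) :=
  hF.comp (by fun_prop) fun _ ht => sub_mem_Icc_zero ht

/-- Gronwall's inequality backwards in time. -/
theorem le_mul_expWeight_of_le_integral_backward (hk : IntegrableOn k (Icc 0 T))
    (hk0 : ∀ t, 0 ≤ k t) {u : ℝ → ℝ} (hu : ContinuousOn u (Icc 0 T)) {a : ℝ} (ha : 0 ≤ a)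
    (h : ∀ t ∈ Icc 0 T, u t ≤ a + ∫ s in t..T, k s * u s) {t : ℝ} (ht : t ∈ Icc 0 T) :
    u t ≤ 2 * a * expWeight k T := by
  have h1 := le_mul_expWeight_of_le_integral hk.comp_sub_left_Icc (fun t => hk0 (T - t))
    hu.comp_sub_left_Icc ha (fun s hs => ?_) (sub_mem_Icc_zero ht)
  · have h2 := expWeight_mono hk.comp_sub_left_Icc (fun t => hk0 (T - t))
      (sub_mem_Icc_zero ht).1 (sub_mem_Icc_zero ht).2 le_rfl
    rw [expWeight_comp_sub_left] at h2
    simp only [sub_sub_cancel] at h1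
    exact h1.trans (mul_le_mul_of_nonneg_left h2 (by positivity))
  · have := h _ (sub_mem_Icc_zero hs)
    rw [intervalIntegral.integral_comp_sub_left (fun s => k s * u s) T, sub_zero]
    exact this

variable [NormedSpace ℝ E]

theorem integrableOn_clm_apply {B : ℝ → E →L[ℝ] E}
    (hB : AEStronglyMeasurable B (volume.restrict (Icc 0 T))) (hk : IntegrableOn k (Icc 0 T))
    (hBk : ∀ᵐ t ∂(volume.restrict (Icc 0 T)), ‖B t‖ ≤ k t) {p : ℝ → E}
    (hp : ContinuousOn p (Icc 0 T)) : IntegrableOn (fun t => B t (p t)) (Icc 0 T) := by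
  obtain ⟨C, hC⟩ := isCompact_Icc.exists_bound_of_continuousOn hp
  refine (hk.mul_const C).mono' ((ContinuousLinearMap.id ℝ (E →L[ℝ] E)).aestronglyMeasurable_comp₂ hB (hp.aestronglyMeasurable_of_isCompact isCompact_Icc
    measurableSet_Icc)) ?_
  filter_upwards [hBk, ae_restrict_mem measurableSet_Icc] with t ht htI
  exact ((B t).le_opNorm _).trans (mul_le_mul ht (hC t htI) (norm_nonneg _)
    ((norm_nonneg _).trans ht))

/-- Existence for a linear differential equation with a terminal condition. -/
theorem exists_linear_backward [CompleteSpace E] (hk : IntegrableOn k (Icc 0 T))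
    (hk0 : ∀ t, 0 ≤ k t) {B : ℝ → E →L[ℝ] E}
    (hB : AEStronglyMeasurable B (volume.restrict (Icc 0 T)))
    (hBk : ∀ᵐ t ∂(volume.restrict (Icc 0 T)), ‖B t‖ ≤ k t) (q : E) :
    ∃ p : ℝ → E, ContinuousOn p (Icc 0 T) ∧
      ∀ t ∈ Icc 0 T, p t = q + ∫ s in t..T, B s (p s) := by
  have hmp := measurePreserving_sub_left_restrict_Icc T
  have hB' : AEStronglyMeasurable (fun t => B (T - t)) (volume.restrict (Icc 0 T)) :=
    hB.comp_measurePreserving hmp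
  have hBk' : ∀ᵐ t ∂(volume.restrict (Icc 0 T)), ‖B (T - t)‖ ≤ k (T - t) :=
    hmp.quasiMeasurePreserving.ae hBk
  -- After time reversal, `a` bounds the residual of the constant curve `q`. The Lipschitz bound is
  -- global, so `r` can be taken as large as existence requires; `max a 0` covers a negative `T`.
  set a := ‖q‖ * ∫ s in (0 : ℝ)..T, k (T - s) with hadef
  obtain ⟨y, hyc, hy, -⟩ := exists_integral_curve_near (T := T) hk.comp_sub_left_Icc
    (fun t => hk0 (T - t)) (F := fun t x => B (T - t) x) (z := fun _ => q)
    (a := max a 0) (r := 2 * max a 0 * expWeight (fun s => k (T - s)) T) continuousOn_const q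
    (fun y hy _ => integrableOn_clm_apply hB' hk.comp_sub_left_Icc hBk' hy)
    (by
      filter_upwards [hBk'] with t ht x _ x' _
      rw [← map_sub]
      exact ((B (T - t)).le_opNorm _).trans (mul_le_mul_of_nonneg_right ht (norm_nonneg _)))
    (fun t ht => by
      have h0T : (0 : ℝ) ∈ Icc 0 T := ⟨le_rfl, ht.1.trans ht.2⟩
      have hTT : T ∈ Icc 0 T := ⟨ht.1.trans ht.2, le_rfl⟩
      have hki := hk.comp_sub_left_Icc
      rw [add_sub_cancel_left]
      refine le_trans ?_ (le_max_left _ _)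
      calc _ ≤ ∫ s in (0 : ℝ)..t, ‖q‖ * k (T - s) := by
            refine intervalIntegral.norm_integral_le_of_norm_le ht.1 ?_
              ((hki.intervalIntegrable_of_mem h0T ht).const_mul _)
            rw [ae_restrict_iff' measurableSet_Icc] at hBk'
            filter_upwards [hBk'] with s hs hst
            rw [mul_comm]
            exact ((B (T - s)).le_opNorm _).trans (mul_le_mul_of_nonneg_right
              (hs ⟨hst.1.le, hst.2.trans ht.2⟩) (norm_nonneg _))
        _ ≤ a := by
            rw [intervalIntegral.integral_const_mul, hadef]
            refine mul_le_mul_of_nonneg_left ?_ (norm_nonneg _)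
            exact intervalIntegral.integral_mono_interval le_rfl ht.1 ht.2
              (Eventually.of_forall fun s => hk0 (T - s))
              (hki.intervalIntegrable_of_mem h0T hTT))
    (le_max_right _ _) le_rfl
  refine ⟨fun t => y (T - t), hyc.comp_sub_left_Icc, fun t ht => ?_⟩
  have h1 := hy _ (sub_mem_Icc_zero ht)
  have h2 := intervalIntegral.integral_comp_sub_left (fun s => B s (y (T - s))) T
    (a := 0) (b := T - t)
  simp only [sub_sub_cancel, sub_zero] at h2
  rw [← h2]
  exact h1

/-- Stability of a linear differential equation with a terminal condition. -/
theorem norm_sub_le_of_linear_backward (hk : IntegrableOn k (Icc 0 T)) (hk0 : ∀ t, 0 ≤ k t)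
    {B B' : ℝ → E →L[ℝ] E} (hB : AEStronglyMeasurable B (volume.restrict (Icc 0 T)))
    (hBk : ∀ᵐ t ∂(volume.restrict (Icc 0 T)), ‖B t‖ ≤ k t)
    (hB' : AEStronglyMeasurable B' (volume.restrict (Icc 0 T)))
    (hBk' : ∀ᵐ t ∂(volume.restrict (Icc 0 T)), ‖B' t‖ ≤ k t) {p p' : ℝ → E} {q q' : E}
    (hpc : ContinuousOn p (Icc 0 T)) (hp : ∀ t ∈ Icc 0 T, p t = q + ∫ s in t..T, B s (p s))
    (hpc' : ContinuousOn p' (Icc 0 T)) (hp' : ∀ t ∈ Icc 0 T, p' t = q' + ∫ s in t..T, B' s (p' s))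
    {M : ℝ} (hM : ∀ t ∈ Icc 0 T, ‖p' t‖ ≤ M) {t : ℝ} (ht : t ∈ Icc 0 T) :
    ‖p t - p' t‖ ≤ 2 * (‖q - q'‖ + M * ∫ s in Icc 0 T, ‖B s - B' s‖) * expWeight k T := by
  have hM0 : 0 ≤ M := (norm_nonneg _).trans (hM t ht)
  have hTT : T ∈ Icc 0 T := ⟨ht.1.trans ht.2, le_rfl⟩
  have hdi : IntegrableOn (fun s => ‖B s - B' s‖) (Icc 0 T) := by
    refine (hk.add hk).mono' (hB.sub hB').norm ?_
    filter_upwards [hBk, hBk'] with s h1 h2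
    rw [norm_norm]
    exact (norm_sub_le _ _).trans (add_le_add h1 h2)
  have hc : ContinuousOn (fun t => ‖p t - p' t‖) (Icc 0 T) := (hpc.sub hpc').norm
  refine le_mul_expWeight_of_le_integral_backward hk hk0 hc (add_nonneg (norm_nonneg _)
    (mul_nonneg hM0 (integral_nonneg fun s => norm_nonneg _))) (fun t ht => ?_) ht
  have hi := (integrableOn_clm_apply hB hk hBk hpc).intervalIntegrable_of_mem ht hTT
  have hi' := (integrableOn_clm_apply hB' hk hBk' hpc').intervalIntegrable_of_mem ht hTT
  have hd := (hdi.intervalIntegrable_of_mem ht hTT).const_mul M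
  have hkd := (hk.mul_continuousOn hc isCompact_Icc).intervalIntegrable_of_mem ht hTT
  have h1 : ‖∫ s in t..T, (B s (p s) - B' s (p' s))‖
      ≤ ∫ s in t..T, (M * ‖B s - B' s‖ + k s * ‖p s - p' s‖) := by
    refine intervalIntegral.norm_integral_le_of_norm_le ht.2 ?_ (hd.add hkd)
    rw [ae_restrict_iff' measurableSet_Icc] at hBk
    filter_upwards [hBk] with s hs hst
    have hsT : s ∈ Icc 0 T := ⟨ht.1.trans hst.1.le, hst.2⟩
    -- The coefficient difference multiplies `p'` alone, so an a priori bound is needed for only one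
    -- of the two solutions, the fixed one in a limit.
    have h2 : B s (p s) - B' s (p' s) = (B s - B' s) (p' s) + B s (p s - p' s) := by
      simp
    rw [h2]
    refine (norm_add_le _ _).trans (add_le_add ?_ ?_)
    · rw [mul_comm]
      exact ((B s - B' s).le_opNorm _).trans
        (mul_le_mul_of_nonneg_left (hM s hsT) (norm_nonneg _))
    · exact ((B s).le_opNorm _).trans (mul_le_mul_of_nonneg_right (hs hsT) (norm_nonneg _))
  rw [intervalIntegral.integral_add hd hkd, intervalIntegral.integral_const_mul] at h1
  have h3 : ∫ s in t..T, ‖B s - B' s‖ ≤ ∫ s in Icc 0 T, ‖B s - B' s‖ := by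
    rw [intervalIntegral.integral_of_le ht.2]
    exact setIntegral_mono_set hdi (Eventually.of_forall fun s => norm_nonneg _)
      (Eventually.of_forall fun s hs => ⟨ht.1.trans hs.1.le, hs.2⟩)
  have h4 : p t - p' t = (q - q') + ∫ s in t..T, (B s (p s) - B' s (p' s)) := by
    rw [hp t ht, hp' t ht, intervalIntegral.integral_sub hi hi']; abel
  calc _ ≤ ‖q - q'‖ + ‖∫ s in t..T, (B s (p s) - B' s (p' s))‖ := by
        rw [h4]; exact norm_add_le _ _
    _ ≤ _ := by
        have := mul_le_mul_of_nonneg_left h3 hM0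
        linarith

theorem norm_le_of_linear_backward (hk : IntegrableOn k (Icc 0 T)) (hk0 : ∀ t, 0 ≤ k t)
    {B : ℝ → E →L[ℝ] E} (hB : AEStronglyMeasurable B (volume.restrict (Icc 0 T)))
    (hBk : ∀ᵐ t ∂(volume.restrict (Icc 0 T)), ‖B t‖ ≤ k t) {p : ℝ → E} {q : E}
    (hpc : ContinuousOn p (Icc 0 T)) (hp : ∀ t ∈ Icc 0 T, p t = q + ∫ s in t..T, B s (p s))
    {t : ℝ} (ht : t ∈ Icc 0 T) : ‖p t‖ ≤ 2 * ‖q‖ * expWeight k T := by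
  simpa using norm_sub_le_of_linear_backward hk hk0 hB hBk hB hBk hpc hp
    (p' := fun _ => 0) (q' := 0) continuousOn_const (by simp) (M := 0) (by simp) ht

end Backward

/-! ### Adjoint arcs and their continuity in the parameter. -/

section Measurability

theorem measurable_clm_of_forall_apply {Z : Type*} [MeasurableSpace Z] {n : ℕ}
    {M : Z → Euc n →L[ℝ] Euc n} (h : ∀ v, Measurable fun z => M z v) : Measurable M := by
  let b := EuclideanSpace.basisFun (Fin n) ℝ
  have hsum : M = fun z => ∑ i, ContinuousLinearMap.smulRightL ℝ (Euc n) (Euc n)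
      (EuclideanSpace.proj i : Euc n →L[ℝ] ℝ) (M z (b i)) := by
    ext1 z
    ext1 v
    conv_lhs => rw [← b.sum_repr v]
    simp [b]
  rw [hsum]
  exact Finset.measurable_sum _ fun i _ =>
    (ContinuousLinearMap.smulRightL ℝ (Euc n) (Euc n)
      (EuclideanSpace.proj i : Euc n →L[ℝ] ℝ)).continuous.measurable.comp (h _)

end Measurability

namespace AverageProblem

variable {n m : ℕ} {Ω : Type*} [MeasurableSpace Ω] {P : AverageProblem n m Ω}
  {ubar : ℝ → Euc m} {xbar : ℝ → Ω → Euc n} {δ c : ℝ} {k : ℝ → ℝ} {I : Set ℝ}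

theorem RegularTimes.measurable_gradF (R : P.RegularTimes ubar xbar δ c k I)
    (hx : P.IsControlledPair ubar xbar) (hδ : 0 < δ) (ω : Ω) :
    Measurable fun t : I => P.gradF t (xbar t ω) (ubar t) ω := by
  refine measurable_clm_of_forall_apply fun v => ?_
  -- The derivative in direction `v` is a limit of difference quotients. Steps shorter than `1 / N`
  -- keep the displaced point in the tube, where substitution is measurable.
  obtain ⟨N, hN⟩ := exists_nat_gt (‖v‖ / δ)
  have hpos : ∀ j : ℕ, (0 : ℝ) < N + 1 + j := fun j => by positivity
  have hxm : Measurable fun t : I => xbar t ω :=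
    ((hx.continuousOn ω).mono R.subset).domRestrict.measurable
  refine measurable_of_tendsto_metrizable (f := fun (j : ℕ) (t : I) => ((N : ℝ) + 1 + j) •
    (P.f t (xbar t ω + ((N : ℝ) + 1 + j)⁻¹ • v) (ubar t) ω - P.f t (xbar t ω) (ubar t) ω))
    (fun j => ?_) (tendsto_pi_nhds.2 fun t => ?_)
  · refine Measurable.const_smul (g := fun t : I =>
      P.f t (xbar t ω + ((N : ℝ) + 1 + j)⁻¹ • v) (ubar t) ω - P.f t (xbar t ω) (ubar t) ω)
      (Measurable.sub ?_ ?_) ((N : ℝ) + 1 + j)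
    · refine R.measurable_comp measurable_subtype_coe R.measurable_ubar_coe measurable_const
        (hxm.add_const _) (fun t => t.2) (fun t => R.ubar_mem t t.2) fun t => ?_
      rw [mem_closedBall_iff_norm, add_sub_cancel_left, norm_smul, norm_inv, Real.norm_of_nonneg
        (hpos j).le, inv_mul_le_iff₀ (hpos j)]
      rw [div_lt_iff₀ hδ] at hN
      have : 0 ≤ (1 + (j : ℝ)) * δ := by positivity
      nlinarith
    · exact R.measurable_comp measurable_subtype_coe R.measurable_ubar_coe measurable_const
        hxm (fun t => t.2) (fun t => R.ubar_mem t t.2) fun t => Metric.mem_closedBall_self hδ.le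
  · refine (R.differentiableAt t t.2 ω _ (R.ubar_mem t t.2) _
      (Metric.mem_closedBall_self hδ.le)).hasFDerivAt.lim v ?_
    refine tendsto_norm_atTop_atTop.comp ?_
    exact tendsto_atTop_add_const_left _ _ tendsto_natCast_atTop_atTop

theorem RegularTimes.aestronglyMeasurable_gradF (R : P.RegularTimes ubar xbar δ c k I)
    (hx : P.IsControlledPair ubar xbar) (hδ : 0 < δ) (ω : Ω) :
    AEStronglyMeasurable (fun t => P.gradF t (xbar t ω) (ubar t) ω)
      (volume.restrict (Icc 0 P.T)) :=
  aestronglyMeasurable_restrict_of_ae_mem R.measurableSet R.ae_mem (R.measurable_gradF hx hδ ω)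

end AverageProblem

/-- Joint measurability of a function which is continuous in each variable. -/
theorem measurable_comp_of_continuous {n : ℕ} {Ω : Type*} [TopologicalSpace Ω] [MeasurableSpace Ω]
    [OpensMeasurableSpace Ω] {T : ℝ} {y : ℝ → Ω → Euc n}
    (hy : ∀ ω, ContinuousOn (fun t => y t ω) (Icc 0 T)) (hy' : ∀ t ∈ Icc 0 T, Continuous (y t))
    {Z : Type*} [MeasurableSpace Z] {τ : Z → ℝ} {o : Z → Ω} (hτ : Measurable τ) (ho : Measurable o)
    (hτT : ∀ z, τ z ∈ Icc 0 T) : Measurable fun z => y (τ z) (o z) := by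
  have h1 : Measurable (Function.uncurry fun (t : Icc 0 T) ω => y t ω) :=
    measurable_uncurry_of_continuous_of_measurable (fun ω => (hy ω).domRestrict)
      fun t => (hy' t t.2).measurable
  exact h1.comp ((hτ.subtype_mk (h := hτT)).prodMk ho)

namespace AverageProblem

variable {n m : ℕ} {Ω : Type*} {P : AverageProblem n m Ω}
  {ubar : ℝ → Euc m} {xbar : ℝ → Ω → Euc n} {δ c : ℝ} {k : ℝ → ℝ} {I : Set ℝ}

/-- `t ↦ ∇ₓf(t, x̄(t,ω), ū(t), ω)ᵀ`. -/
noncomputable def adjointF (P : AverageProblem n m Ω) (ubar : ℝ → Euc m) (xbar : ℝ → Ω → Euc n)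
    (ω : Ω) (t : ℝ) : Euc n →L[ℝ] Euc n :=
  ContinuousLinearMap.adjoint (P.gradF t (xbar t ω) (ubar t) ω)

/-- The adjoint arcs: solutions of the adjoint equation with terminal value `-∇g`, in integral
form. -/
structure IsAdjoint (P : AverageProblem n m Ω) (ubar : ℝ → Euc m) (xbar p : ℝ → Ω → Euc n) :
    Prop where
  continuousOn : ∀ ω, ContinuousOn (fun t => p t ω) (Icc 0 P.T)
  eq_integral : ∀ ω, ∀ t ∈ Icc 0 P.T, p t ω = -gradient (fun y => P.g y ω) (xbar P.T ω)
    + ∫ s in t..P.T, P.adjointF ubar xbar ω s (p s ω)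

theorem IsAdjoint.apply_end {p : ℝ → Ω → Euc n} (hp : P.IsAdjoint ubar xbar p) (ω : Ω) :
    p P.T ω = -gradient (fun y => P.g y ω) (xbar P.T ω) := by
  simpa using hp.eq_integral ω P.T ⟨P.T_pos.le, le_rfl⟩

section

variable [MeasurableSpace Ω]

theorem RegularTimes.norm_adjointF_le (R : P.RegularTimes ubar xbar δ c k I) (hδ : 0 < δ) (ω : Ω) :
    ∀ᵐ t ∂(volume.restrict (Icc 0 P.T)), ‖P.adjointF ubar xbar ω t‖ ≤ k t := by
  filter_upwards [R.ae_mem] with t ht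
  rw [adjointF, LinearIsometryEquiv.norm_map]
  exact R.norm_gradF_le ht (R.ubar_mem t ht) (Metric.mem_ball_self hδ)

theorem RegularTimes.aestronglyMeasurable_adjointF (R : P.RegularTimes ubar xbar δ c k I)
    (hx : P.IsControlledPair ubar xbar) (hδ : 0 < δ) (ω : Ω) :
    AEStronglyMeasurable (P.adjointF ubar xbar ω) (volume.restrict (Icc 0 P.T)) :=
  (ContinuousLinearMap.adjoint (𝕜 := ℝ) (E := Euc n) (F := Euc n)).continuous
    |>.comp_aestronglyMeasurable (R.aestronglyMeasurable_gradF hx hδ ω)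

theorem RegularTimes.exists_isAdjoint (R : P.RegularTimes ubar xbar δ c k I)
    (hx : P.IsControlledPair ubar xbar) (hδ : 0 < δ) : ∃ p, P.IsAdjoint ubar xbar p := by
  choose p hp using fun ω => exists_linear_backward R.integrableOn R.nonneg
    (R.aestronglyMeasurable_adjointF hx hδ ω) (R.norm_adjointF_le hδ ω)
    (-gradient (fun y => P.g y ω) (xbar P.T ω))
  exact ⟨fun t ω => p ω t, fun ω => (hp ω).1, fun ω => (hp ω).2⟩

theorem IsAdjoint.norm_le {p : ℝ → Ω → Euc n} (hp : P.IsAdjoint ubar xbar p)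
    (R : P.RegularTimes ubar xbar δ c k I) (hx : P.IsControlledPair ubar xbar) (hδ : 0 < δ) (ω : Ω)
    {t : ℝ} (ht : t ∈ Icc 0 P.T) :
    ‖p t ω‖ ≤ 2 * ‖gradient (fun y => P.g y ω) (xbar P.T ω)‖ * expWeight k P.T := by
  simpa using norm_le_of_linear_backward R.integrableOn R.nonneg
    (R.aestronglyMeasurable_adjointF hx hδ ω) (R.norm_adjointF_le hδ ω) (hp.continuousOn ω)
    (hp.eq_integral ω) ht

theorem IsAdjoint.isW11 {p : ℝ → Ω → Euc n} (hp : P.IsAdjoint ubar xbar p)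
    (R : P.RegularTimes ubar xbar δ c k I) (hx : P.IsControlledPair ubar xbar) (hδ : 0 < δ)
    (ω : Ω) :
    IsW11 P.T (fun t => p t ω) ∧ ∀ᵐ t ∂(volume.restrict (Icc 0 P.T)),
      HasDerivAt (fun s => p s ω) (-(P.adjointF ubar xbar ω t (p t ω))) t := by
  have h0T : (0 : ℝ) ∈ Icc 0 P.T := ⟨le_rfl, P.T_pos.le⟩
  have hTT : P.T ∈ Icc 0 P.T := ⟨P.T_pos.le, le_rfl⟩
  have hi := integrableOn_clm_apply (R.aestronglyMeasurable_adjointF hx hδ ω) R.integrableOn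
    (R.norm_adjointF_le hδ ω) (hp.continuousOn ω)
  refine isW11_of_eq_integral P.T_pos.le (y₀ := p 0 ω) hi.neg fun t ht => ?_
  rw [intervalIntegral.integral_neg, hp.eq_integral ω t ht, hp.eq_integral ω 0 h0T,
    ← intervalIntegral.integral_add_adjacent_intervals (hi.intervalIntegrable_of_mem h0T ht)
      (hi.intervalIntegrable_of_mem ht hTT)]
  abel

end

section Continuity

variable [PseudoMetricSpace Ω] [MeasurableSpace Ω]

/-- Dominated convergence with bound `2 * k`. Pointwise, the parameter is changed first at the moved
state `xbar t (s j)`, by the uniform hypothesis, and then the state is moved at the fixed parameter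
`ω`. -/
theorem RegularTimes.tendsto_integral_adjointF (R : P.RegularTimes ubar xbar δ c k I)
    (hx : P.IsControlledPair ubar xbar) (hδ : 0 < δ) (hf : P.SmoothDynamics xbar δ)
    (hxc : ∀ t ∈ Icc 0 P.T, Continuous (xbar t)) {ω : Ω} {s : ℕ → Ω}
    (hs : Tendsto s atTop (𝓝 ω)) :
    Tendsto (fun j => ∫ t in Icc 0 P.T, ‖P.adjointF ubar xbar (s j) t - P.adjointF ubar xbar ω t‖)
      atTop (𝓝 0) := by
  have hsm : ∀ ω, AEStronglyMeasurable (P.adjointF ubar xbar ω) (volume.restrict (Icc 0 P.T)) :=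
    R.aestronglyMeasurable_adjointF hx hδ
  rw [show 𝓝 (0 : ℝ) = 𝓝 (∫ _ in Icc 0 P.T, (0 : ℝ)) by simp]
  choose r hr hr' using fun i : ℕ => hf.2 ω (1 / (i + 1)) (by positivity)
  -- The null set in the hypothesis depends on the second parameter. Along a sequence only countably
  -- many occur, hence the sequential formulation.
  have hall : ∀ᵐ t ∂(volume.restrict (Icc 0 P.T)), ∀ i j, dist ω (s j) < r i → ∀ u ∈ P.U t,
      ∀ x ∈ Metric.closedBall (xbar t ω) δ ∩ Metric.closedBall (xbar t (s j)) δ,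
        ‖P.gradF t x u ω - P.gradF t x u (s j)‖ ≤ 1 / ((i : ℝ) + 1) := by
    refine ae_all_iff.2 fun i => ae_all_iff.2 fun j => ?_
    by_cases h : dist ω (s j) < r i
    · exact (hr' i _ h).mono fun t ht _ => ht
    · exact Eventually.of_forall fun t h' => absurd h' h
  refine tendsto_integral_of_dominated_convergence (fun t => 2 * k t)
    (fun j => ((hsm _).sub (hsm _)).norm) (R.integrableOn.const_mul 2) (fun j => ?_) ?_
  · filter_upwards [R.norm_adjointF_le hδ (s j), R.norm_adjointF_le hδ ω] with t h1 h2
    rw [norm_norm]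
    exact (norm_sub_le _ _).trans (by linarith)
  · filter_upwards [hall, R.ae_mem] with t ht htI
    have hu := R.ubar_mem t htI
    have hxs : Tendsto (fun j => xbar t (s j)) atTop (𝓝 (xbar t ω)) :=
      ((hxc t (R.subset htI)).tendsto ω).comp hs
    have hball : ∀ᶠ j in atTop, xbar t (s j) ∈ Metric.closedBall (xbar t ω) δ :=
      hxs.eventually (Metric.closedBall_mem_nhds _ hδ)
    have h2 : Tendsto (fun j => ‖P.gradF t (xbar t (s j)) (ubar t) ω
        - P.gradF t (xbar t ω) (ubar t) ω‖) atTop (𝓝 0) :=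
      tendsto_iff_norm_sub_tendsto_zero.1 (((R.continuousOn_gradF t htI ω _ hu _
        (Metric.mem_closedBall_self hδ.le)).tendsto).comp
          (tendsto_nhdsWithin_iff.2 ⟨hxs, hball⟩))
    have h1 : Tendsto (fun j => ‖P.gradF t (xbar t (s j)) (ubar t) (s j)
        - P.gradF t (xbar t (s j)) (ubar t) ω‖) atTop (𝓝 0) := by
      rw [Metric.tendsto_nhds]
      intro ε hε
      obtain ⟨i, hi⟩ := exists_nat_one_div_lt hε
      filter_upwards [hball, hs.eventually (Metric.ball_mem_nhds ω (hr i))] with j hj hj'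
      rw [dist_comm] at hj'
      rw [dist_zero_right, norm_norm, norm_sub_rev]
      exact (ht i j hj' _ hu _ ⟨hj, Metric.mem_closedBall_self hδ.le⟩).trans_lt hi
    refine squeeze_zero (fun j => norm_nonneg _) (fun j => ?_) (by simpa using h1.add h2)
    rw [adjointF, adjointF, ← map_sub, LinearIsometryEquiv.norm_map]
    exact norm_sub_le_norm_sub_add_norm_sub _ _ _

/-- Terminal values are continuous in `ω` and the coefficients converge in `L¹`, so linear stability
applies. The constant `M` bounds the arc at the limit parameter only. -/
theorem IsAdjoint.continuous {p : ℝ → Ω → Euc n} (hp : P.IsAdjoint ubar xbar p)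
    (R : P.RegularTimes ubar xbar δ c k I) (hx : P.IsControlledPair ubar xbar) (hδ : 0 < δ)
    (hf : P.SmoothDynamics xbar δ) (hg : P.SmoothCost xbar δ)
    (hxc : ∀ t ∈ Icc 0 P.T, Continuous (xbar t)) {t : ℝ} (ht : t ∈ Icc 0 P.T) :
    Continuous (p t) := by
  have hTT : P.T ∈ Icc 0 P.T := ⟨P.T_pos.le, le_rfl⟩
  have hgc : Continuous fun ω => gradient (fun y => P.g y ω) (xbar P.T ω) :=
    hg.2.comp_continuous ((hxc _ hTT).prodMk continuous_id)
      fun ω => Metric.mem_closedBall_self hδ.le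
  rw [continuous_iff_seqContinuous]
  intro s ω hs
  rw [tendsto_iff_norm_sub_tendsto_zero]
  obtain ⟨M, hM⟩ := isCompact_Icc.exists_bound_of_continuousOn (hp.continuousOn ω)
  have h1 : Tendsto (fun j => ‖-gradient (fun y => P.g y (s j)) (xbar P.T (s j))
      - -gradient (fun y => P.g y ω) (xbar P.T ω)‖) atTop (𝓝 0) :=
    tendsto_iff_norm_sub_tendsto_zero.1 ((hgc.neg.tendsto ω).comp hs)
  have h2 := ((h1.add ((R.tendsto_integral_adjointF hx hδ hf hxc hs).const_mul M)).const_mul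
    2).mul_const (expWeight k P.T)
  simp only [mul_zero, add_zero, zero_mul] at h2
  exact squeeze_zero (fun j => norm_nonneg _) (fun j => norm_sub_le_of_linear_backward
    R.integrableOn R.nonneg (R.aestronglyMeasurable_adjointF hx hδ _) (R.norm_adjointF_le hδ _)
    (R.aestronglyMeasurable_adjointF hx hδ _) (R.norm_adjointF_le hδ _) (hp.continuousOn _)
    (hp.eq_integral _) (hp.continuousOn _) (hp.eq_integral _) hM ht) h2

end Continuity

end AverageProblem

theorem MeasureTheory.IntegrableOn.inner_of_continuousOn {E : Type*} [NormedAddCommGroup E]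
    [InnerProductSpace ℝ E] {T : ℝ} {p F : ℝ → E} (hF : IntegrableOn F (Icc 0 T))
    (hp : ContinuousOn p (Icc 0 T)) : IntegrableOn (fun s => inner ℝ (p s) (F s)) (Icc 0 T) := by
  obtain ⟨C, hC⟩ := isCompact_Icc.exists_bound_of_continuousOn hp
  refine (hF.norm.const_mul C).mono' ((hp.aestronglyMeasurable_of_isCompact isCompact_Icc
    measurableSet_Icc).inner hF.aestronglyMeasurable) ?_
  filter_upwards [ae_restrict_mem measurableSet_Icc] with t htI
  exact (norm_inner_le_norm _ _).trans (mul_le_mul_of_nonneg_right (hC t htI) (norm_nonneg _))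

/-! ### First-order expansion of state and cost. -/

namespace AverageProblem

variable {n m : ℕ} {Ω : Type*} {P : AverageProblem n m Ω} {w : ℝ → Euc m} {y : ℝ → Ω → Euc n}
  {ubar : ℝ → Euc m} {xbar p : ℝ → Ω → Euc n} {δ c : ℝ} {k : ℝ → ℝ} {I : Set ℝ}
  [MeasurableSpace Ω]

/-- Duality between the adjoint equation and the variation of the state. -/
theorem IsAdjoint.inner_eq_integral (hp : P.IsAdjoint ubar xbar p)
    (R : P.RegularTimes ubar xbar δ c k I) (hx : P.IsControlledPair ubar xbar) (hδ : 0 < δ)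
    (hy : P.IsControlledPair w y) (ω : Ω)
    (hyδ : ∀ t ∈ Icc 0 P.T, y t ω ∈ Metric.closedBall (xbar t ω) δ) :
    inner ℝ (p P.T ω) (y P.T ω - xbar P.T ω) = ∫ s in Icc 0 P.T, inner ℝ (p s ω)
      (P.f s (y s ω) (w s) ω - P.f s (xbar s ω) (ubar s) ω
        - P.gradF s (xbar s ω) (ubar s) ω (y s ω - xbar s ω)) := by
  have h0T : (0 : ℝ) ∈ Icc 0 P.T := ⟨le_rfl, P.T_pos.le⟩
  have hTT : P.T ∈ Icc 0 P.T := ⟨P.T_pos.le, le_rfl⟩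
  have hxδ : ∀ t ∈ Icc 0 P.T, xbar t ω ∈ Metric.closedBall (xbar t ω) δ := fun t _ =>
    Metric.mem_closedBall_self hδ.le
  obtain ⟨hpac, hpd⟩ := hp.isW11 R hx hδ ω
  have hac := AbsolutelyContinuousOnInterval.inner hpac ((hy.2 ω).1.sub (hx.2 ω).1)
  have hgrad : IntegrableOn (fun s => P.gradF s (xbar s ω) (ubar s) ω (y s ω - xbar s ω))
      (Icc 0 P.T) := integrableOn_clm_apply (R.aestronglyMeasurable_gradF hx hδ ω) R.integrableOn
    (R.ae_mem.mono fun t ht => R.norm_gradF_le ht (R.ubar_mem t ht) (Metric.mem_ball_self hδ))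
    ((hy.continuousOn ω).sub (hx.continuousOn ω))
  have hi := (((hy.integrableOn R ω hyδ).sub (hx.integrableOn R ω hxδ)).sub
    hgrad).inner_of_continuousOn (hp.continuousOn ω)
  have h := hac.eq_add_integral P.T_pos.le (F := fun s => inner ℝ (p s ω)
      (P.f s (y s ω) (w s) ω - P.f s (xbar s ω) (ubar s) ω
        - P.gradF s (xbar s ω) (ubar s) ω (y s ω - xbar s ω))) (by
    filter_upwards [hpd, (hy.2 ω).2.2, (hx.2 ω).2.2] with s h1 h2 h3
    -- The adjoint equation cancels the linear part of the variation, leaving only the velocity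
    -- difference minus its linearization.
    refine (h1.inner ℝ (h2.sub h3)).congr_deriv ?_
    simp only [adjointF, Pi.sub_apply, inner_neg_left, ContinuousLinearMap.adjoint_inner_left,
      inner_sub_right, map_sub]
    ring) (hi.intervalIntegrable_of_mem h0T hTT) hTT
  simp only [Pi.sub_apply, (hy.2 ω).2.1, (hx.2 ω).2.1, sub_self, inner_zero_right, zero_add] at h
  rw [h, intervalIntegral.integral_of_le P.T_pos.le, integral_Icc_eq_integral_Ioc]

open Classical in
/-- First order expansion of the state along a sequence of variations of the control on shrinking
sets of times. -/
theorem IsAdjoint.tendsto_inner_sub_integral (hp : P.IsAdjoint ubar xbar p)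
    (R : P.RegularTimes ubar xbar δ c k I) (hx : P.IsControlledPair ubar xbar) (hδ : 0 < δ)
    {A : ℕ → Set ℝ} (hA : ∀ j, MeasurableSet (A j)) {v : ℝ → Euc m} (hv : Measurable v)
    (hvU : ∀ j, ∀ t ∈ A j, v t ∈ P.U t) {y : ℕ → ℝ → Ω → Euc n}
    (hy : ∀ j, P.IsControlledPair ((A j).piecewise v ubar) (y j)) (ω : Ω)
    (hyδ : ∀ j, ∀ t ∈ Icc 0 P.T, y j t ω ∈ Metric.closedBall (xbar t ω) δ) {h : ℕ → ℝ}
    (hh : ∀ j, 0 < h j) (hh0 : Tendsto h atTop (𝓝 0)) {K : ℝ}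
    (hyK : ∀ j, ∀ t ∈ Icc 0 P.T, ‖y j t ω - xbar t ω‖ ≤ K * h j)
    (hsh : ∀ᵐ t ∂(volume.restrict (Icc 0 P.T)), ∀ᶠ j in atTop, t ∉ A j) :
    Tendsto (fun j => (h j)⁻¹ * (inner ℝ (p P.T ω) (y j P.T ω - xbar P.T ω)
      - ∫ s in Icc 0 P.T, inner ℝ (p s ω) (P.f s (xbar s ω) ((A j).piecewise v ubar s) ω
        - P.f s (xbar s ω) (ubar s) ω))) atTop (𝓝 0) := by
  have hxδ : ∀ t ∈ Icc 0 P.T, xbar t ω ∈ Metric.closedBall (xbar t ω) δ := fun t _ =>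
    Metric.mem_closedBall_self hδ.le
  obtain ⟨M, hM⟩ := isCompact_Icc.exists_bound_of_continuousOn (hp.continuousOn ω)
  have hgradk : ∀ᵐ t ∂(volume.restrict (Icc 0 P.T)), ‖P.gradF t (xbar t ω) (ubar t) ω‖ ≤ k t :=
    R.ae_mem.mono fun t ht => R.norm_gradF_le ht (R.ubar_mem t ht) (Metric.mem_ball_self hδ)
  have hgrad : ∀ j, IntegrableOn (fun s => P.gradF s (xbar s ω) (ubar s) ω (y j s ω - xbar s ω))
      (Icc 0 P.T) := fun j => integrableOn_clm_apply (R.aestronglyMeasurable_gradF hx hδ ω)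
    R.integrableOn hgradk (((hy j).continuousOn ω).sub (hx.continuousOn ω))
  have hfw : ∀ j, IntegrableOn (fun s => P.f s (xbar s ω) ((A j).piecewise v ubar s) ω)
      (Icc 0 P.T) := fun j => R.integrableOn_of_measurable (R.measurable_piecewise_coe (hA j) hv)
    (R.piecewise_mem (hvU j)) ω (hx.continuousOn ω) hxδ
  -- The remainder compares the perturbed control at two states, but linearizes with the reference
  -- control. Inside `A j` it is merely `O(h j)`; this is enough, since almost every time eventually
  -- leaves the sets `A j`, after which differentiability gives `o(h j)`.
  set ρ : ℕ → ℝ → Euc n := fun j s => P.f s (y j s ω) ((A j).piecewise v ubar s) ω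
    - P.f s (xbar s ω) ((A j).piecewise v ubar s) ω
    - P.gradF s (xbar s ω) (ubar s) ω (y j s ω - xbar s ω) with hρ
  have hρi : ∀ j, IntegrableOn (ρ j) (Icc 0 P.T) := fun j =>
    (((hy j).integrableOn R ω (hyδ j)).sub (hfw j)).sub (hgrad j)
  have hcongr : ∀ j, (h j)⁻¹ * (inner ℝ (p P.T ω) (y j P.T ω - xbar P.T ω)
      - ∫ s in Icc 0 P.T, inner ℝ (p s ω) (P.f s (xbar s ω) ((A j).piecewise v ubar s) ω
        - P.f s (xbar s ω) (ubar s) ω))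
      = ∫ s in Icc 0 P.T, inner ℝ (p s ω) ((h j)⁻¹ • ρ j s) := fun j => by
    rw [hp.inner_eq_integral R hx hδ (hy j) ω (hyδ j), ← integral_sub, ← integral_const_mul]
    · refine integral_congr_ae (Eventually.of_forall fun s => ?_)
      simp only [hρ, inner_smul_right, inner_sub_right]
      ring
    · exact ((((hy j).integrableOn R ω (hyδ j)).sub (hx.integrableOn R ω hxδ)).sub
        (hgrad j)).inner_of_continuousOn (hp.continuousOn ω)
    · exact ((hfw j).sub (hx.integrableOn R ω hxδ)).inner_of_continuousOn (hp.continuousOn ω)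
  simp_rw [hcongr]
  rw [show 𝓝 (0 : ℝ) = 𝓝 (∫ _ in Icc 0 P.T, (0 : ℝ)) by simp]
  refine tendsto_integral_of_dominated_convergence (fun s => M * (2 * K * k s))
    (fun j => (IntegrableOn.inner_of_continuousOn (F := fun s => (h j)⁻¹ • ρ j s)
      ((hρi j).smul (h j)⁻¹) (hp.continuousOn ω)).aestronglyMeasurable) ((R.integrableOn.const_mul _).const_mul _)
    (fun j => ?_) ?_
  · filter_upwards [R.ae_mem, hgradk] with s hs hgs
    have hsT := R.subset hs
    refine (norm_inner_le_norm _ _).trans (mul_le_mul (hM s hsT) ?_ (norm_nonneg _)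
      ((norm_nonneg _).trans (hM s hsT)))
    rw [norm_smul, norm_inv, Real.norm_of_nonneg (hh j).le, inv_mul_le_iff₀ (hh j)]
    have h1 := R.lip s hs ω _ (R.piecewise_mem (hvU j) s hs) _ (hyδ j s hsT) _ (hxδ s hsT)
    have h2 := (P.gradF s (xbar s ω) (ubar s) ω).le_opNorm (y j s ω - xbar s ω)
    have h3 := mul_le_mul_of_nonneg_right hgs (norm_nonneg (y j s ω - xbar s ω))
    have h4 := mul_le_mul_of_nonneg_left (hyK j s hsT) (R.nonneg s)
    refine (norm_sub_le _ _).trans ?_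
    linarith
  · filter_upwards [R.ae_mem, hsh] with s hs hsA
    have hsT := R.subset hs
    have hlim : Tendsto (fun j => y j s ω) atTop (𝓝 (xbar s ω)) := by
      rw [tendsto_iff_norm_sub_tendsto_zero]
      exact squeeze_zero (fun j => norm_nonneg _) (fun j => hyK j s hsT)
        (by simpa using hh0.const_mul K)
    have h1 := ((R.differentiableAt s hs ω _ (R.ubar_mem s hs) _
      (hxδ s hsT)).hasFDerivAt.isLittleO.comp_tendsto hlim).trans_isBigO
        (Asymptotics.IsBigO.of_bound (g := h) K (Eventually.of_forall fun j => by
          simpa [Real.norm_of_nonneg (hh j).le] using hyK j s hsT))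
    have h2 := h1.tendsto_inv_smul_nhds_zero
    have h3 : Tendsto (fun j => (h j)⁻¹ • ρ j s) atTop (𝓝 0) := by
      refine h2.congr' ?_
      filter_upwards [hsA] with j hj
      simp only [hρ, piecewise_eq_of_notMem _ _ _ hj]
      rfl
    simpa using (tendsto_const_nhds (x := p s ω)).inner h3

open Classical in
/-- First order expansion of the cost along a sequence of variations of the control on shrinking sets
of times. -/
theorem IsAdjoint.tendsto_cost_quotient (hp : P.IsAdjoint ubar xbar p)
    (R : P.RegularTimes ubar xbar δ c k I) (hx : P.IsControlledPair ubar xbar) (hδ : 0 < δ)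
    {A : ℕ → Set ℝ} (hA : ∀ j, MeasurableSet (A j)) {v : ℝ → Euc m} (hv : Measurable v)
    (hvU : ∀ j, ∀ t ∈ A j, v t ∈ P.U t) {y : ℕ → ℝ → Ω → Euc n}
    (hy : ∀ j, P.IsControlledPair ((A j).piecewise v ubar) (y j)) (ω : Ω)
    (hyδ : ∀ j, ∀ t ∈ Icc 0 P.T, y j t ω ∈ Metric.closedBall (xbar t ω) δ) {h : ℕ → ℝ}
    (hh : ∀ j, 0 < h j) (hh0 : Tendsto h atTop (𝓝 0)) {K : ℝ}
    (hyK : ∀ j, ∀ t ∈ Icc 0 P.T, ‖y j t ω - xbar t ω‖ ≤ K * h j)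
    (hsh : ∀ᵐ t ∂(volume.restrict (Icc 0 P.T)), ∀ᶠ j in atTop, t ∉ A j)
    (hg : DifferentiableAt ℝ (fun z => P.g z ω) (xbar P.T ω)) :
    Tendsto (fun j => (h j)⁻¹ * (P.g (y j P.T ω) ω - P.g (xbar P.T ω) ω)
      + (h j)⁻¹ * ∫ s in Icc 0 P.T, inner ℝ (p s ω)
        (P.f s (xbar s ω) ((A j).piecewise v ubar s) ω - P.f s (xbar s ω) (ubar s) ω))
      atTop (𝓝 0) := by
  have hTT : P.T ∈ Icc 0 P.T := ⟨P.T_pos.le, le_rfl⟩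
  have h1 := hp.tendsto_inner_sub_integral R hx hδ hA hv hvU hy ω hyδ hh hh0 hyK hsh
  have hlim : Tendsto (fun j => y j P.T ω) atTop (𝓝 (xbar P.T ω)) := by
    rw [tendsto_iff_norm_sub_tendsto_zero]
    exact squeeze_zero (fun j => norm_nonneg _) (fun j => hyK j _ hTT)
      (by simpa using hh0.const_mul K)
  have h2 := (((hasGradientAt_iff_isLittleO.1 hg.hasGradientAt).comp_tendsto hlim).trans_isBigO
    (Asymptotics.IsBigO.of_bound (g := h) K (Eventually.of_forall fun j => by
      simpa [Real.norm_of_nonneg (hh j).le] using hyK j _ hTT))).tendsto_inv_smul_nhds_zero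
  have h3 := h2.sub h1
  rw [sub_zero] at h3
  refine h3.congr fun j => ?_
  simp only [Function.comp, smul_eq_mul, hp.apply_end, inner_neg_left]
  ring

theorem RegularTimes.measurable_inner [TopologicalSpace Ω] [OpensMeasurableSpace Ω]
    (R : P.RegularTimes ubar xbar δ c k I) (hx : P.IsControlledPair ubar xbar) (hδ : 0 < δ)
    (hxc : ∀ t ∈ Icc 0 P.T, Continuous (xbar t))
    (hp : ∀ ω, ContinuousOn (fun t => p t ω) (Icc 0 P.T))
    (hpc : ∀ t ∈ Icc 0 P.T, Continuous (p t)) {Z : Type*} [MeasurableSpace Z]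
    {τ : Z → ℝ} {w : Z → Euc m} {o : Z → Ω} (hτ : Measurable τ) (hw : Measurable w)
    (ho : Measurable o) (hτI : ∀ z, τ z ∈ I) (hwU : ∀ z, w z ∈ P.U (τ z)) :
    Measurable fun z => inner ℝ (p (τ z) (o z)) (P.f (τ z) (xbar (τ z) (o z)) (w z) (o z)) := by
  have hT : ∀ z, τ z ∈ Icc 0 P.T := fun z => R.subset (hτI z)
  exact (measurable_comp_of_continuous hp hpc hτ ho hT).inner
    (R.measurable_comp hτ hw ho (measurable_comp_of_continuous hx.continuousOn hxc hτ ho hT) hτI hwU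
      fun z => Metric.mem_closedBall_self hδ.le)

end AverageProblem

/-! ### The averaged Hamiltonian and the needle variation. -/

namespace AverageProblem

variable {n m : ℕ} {Ω : Type*} {P : AverageProblem n m Ω} {w : ℝ → Euc m} {y : ℝ → Ω → Euc n}
  {ubar : ℝ → Euc m} {xbar p : ℝ → Ω → Euc n} {δ c : ℝ} {k : ℝ → ℝ} {I : Set ℝ}

/-- The averaged Hamiltonian along the reference arcs. -/
noncomputable def hamiltonian [MeasurableSpace Ω] (P : AverageProblem n m Ω) (μ : Measure Ω)
    (xbar p : ℝ → Ω → Euc n) (t : ℝ) (u : Euc m) : ℝ :=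
  ∫ ω, inner ℝ (p t ω) (P.f t (xbar t ω) u ω) ∂μ

theorem norm_gradient_le_of_lipschitz {x : Euc n} {ω : Ω} {K : ℝ} (hδ : 0 < δ)
    (hg : DifferentiableAt ℝ (fun z => P.g z ω) x)
    (hl : ∀ z ∈ Metric.closedBall x δ, |P.g z ω - P.g x ω| ≤ K * ‖z - x‖) :
    ‖gradient (fun z => P.g z ω) x‖ ≤ |K| := by
  rw [gradient, LinearIsometryEquiv.norm_map]
  refine hg.hasFDerivAt.le_of_lip' (abs_nonneg K) ?_
  filter_upwards [Metric.closedBall_mem_nhds x hδ] with z hz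
  exact (hl z hz).trans (mul_le_mul_of_nonneg_right (le_abs_self K) (norm_nonneg _))

variable [TopologicalSpace Ω] [MeasurableSpace Ω] {μ : Measure Ω}

/-- A bound, linear in the Lipschitz constant of the cost, on the adjoint arcs. -/
theorem IsAdjoint.norm_le_of_mem_support (hp : P.IsAdjoint ubar xbar p)
    (R : P.RegularTimes ubar xbar δ c k I) (hx : P.IsControlledPair ubar xbar) (hδ : 0 < δ)
    (hg : P.SmoothCost xbar δ) {kg : Ω → ℝ}
    (hkg : ∀ ω ∈ μ.support, ∀ x ∈ Metric.closedBall (xbar P.T ω) δ,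
      ∀ x' ∈ Metric.closedBall (xbar P.T ω) δ, |P.g x ω - P.g x' ω| ≤ kg ω * ‖x - x'‖)
    {ω : Ω} (hω : ω ∈ μ.support) {t : ℝ} (ht : t ∈ Icc 0 P.T) :
    ‖p t ω‖ ≤ 2 * |kg ω| * expWeight k P.T := by
  have hself := Metric.mem_closedBall_self (x := xbar P.T ω) hδ.le
  have h1 := hp.norm_le R hx hδ ω ht
  have h2 := norm_gradient_le_of_lipschitz hδ (hg.1 ω _ hself) fun z hz => hkg ω hω z hz _ hself
  exact h1.trans (by gcongr; exact (expWeight_pos _).le)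

variable [OpensMeasurableSpace Ω]

/-- The integrand is bounded on the support by a multiple of `|kg|`, and the support has full
measure because the space is hereditarily Lindelöf. -/
theorem RegularTimes.integrable_inner [HereditarilyLindelofSpace Ω]
    (R : P.RegularTimes ubar xbar δ c k I) (hx : P.IsControlledPair ubar xbar) (hδ : 0 < δ)
    (hxc : ∀ t ∈ Icc 0 P.T, Continuous (xbar t)) (hp : P.IsAdjoint ubar xbar p)
    (hpc : ∀ t ∈ Icc 0 P.T, Continuous (p t)) {kg : Ω → ℝ} (hkgi : Integrable kg μ)
    (hpb : ∀ ω ∈ μ.support, ∀ t ∈ Icc 0 P.T, ‖p t ω‖ ≤ 2 * |kg ω| * expWeight k P.T) {t : ℝ}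
    (ht : t ∈ I) {u : Euc m} (hu : u ∈ P.U t) :
    Integrable (fun ω => inner ℝ (p t ω) (P.f t (xbar t ω) u ω)) μ := by
  refine ((hkgi.abs.const_mul 2).mul_const (expWeight k P.T) |>.mul_const c).mono'
    (R.measurable_inner hx hδ hxc hp.continuousOn hpc measurable_const measurable_const
      measurable_id (fun _ => ht) (fun _ => hu)).aestronglyMeasurable ?_
  filter_upwards [Measure.support_mem_ae (μ := μ)] with ω hω
  have h1 := hpb ω hω t (R.subset ht)
  exact (norm_inner_le_norm _ _).trans (mul_le_mul h1
    (R.bound t ht ω u hu _ (Metric.mem_closedBall_self hδ.le)) (norm_nonneg _)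
    ((norm_nonneg _).trans h1))

/-- The set of times and controls which improve the averaged Hamiltonian by at least `η` is Borel. -/
theorem RegularTimes.measurableSet_improving [SFinite μ] (R : P.RegularTimes ubar xbar δ c k I)
    (hx : P.IsControlledPair ubar xbar) (hδ : 0 < δ)
    (hxc : ∀ t ∈ Icc 0 P.T, Continuous (xbar t))
    (hp : ∀ ω, ContinuousOn (fun t => p t ω) (Icc 0 P.T))
    (hpc : ∀ t ∈ Icc 0 P.T, Continuous (p t)) (η : ℝ) :
    MeasurableSet {z : ℝ × Euc m | (z.1 ∈ I ∧ z.2 ∈ P.U z.1) ∧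
      η ≤ P.hamiltonian μ xbar p z.1 z.2 - P.hamiltonian μ xbar p z.1 (ubar z.1)} := by
  set G : Set (ℝ × Euc m) := {z | z.1 ∈ I ∧ z.2 ∈ P.U z.1} with hG
  have hH : ∀ {w : G → Euc m}, Measurable w → (∀ z : G, w z ∈ P.U z.1.1) →
      Measurable fun z : G => P.hamiltonian μ xbar p z.1.1 (w z) := fun {w} hw hwU => by
    have h1 : Measurable fun z : G × Ω => inner ℝ (p z.1.1.1 z.2)
        (P.f z.1.1.1 (xbar z.1.1.1 z.2) (w z.1) z.2) :=
      R.measurable_inner hx hδ hxc hp hpc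
        (measurable_fst.comp (measurable_subtype_coe.comp measurable_fst))
        (hw.comp measurable_fst) measurable_snd (fun z => z.1.2.1) fun z => hwU z.1
    exact h1.stronglyMeasurable.integral_prod_right.measurable
  have h1 := hH (w := fun z => z.1.2) (measurable_snd.comp measurable_subtype_coe) fun z => z.2.2
  have h2 := hH (w := fun z => ubar z.1.1) (R.measurable_ubar_coe.comp
    ((measurable_fst.comp measurable_subtype_coe).subtype_mk (h := fun z : G => z.2.1)))
    fun z => R.ubar_mem _ z.2.1
  have h3 := R.graph.subtype_image (measurableSet_le (measurable_const (a := η)) (h1.sub h2))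
  convert h3 using 1
  ext z
  constructor
  · rintro ⟨hz, hz'⟩
    exact ⟨⟨z, hz⟩, hz', rfl⟩
  · rintro ⟨z, hz', rfl⟩
    exact ⟨z.2, hz'⟩

open Classical in
/-- A needle variation: the averaged Hamiltonian cannot be improved on a non-null set of times. -/
theorem IsLocalMinimizer.not_improvable [IsProbabilityMeasure μ] [HereditarilyLindelofSpace Ω]
    (hmin : P.IsLocalMinimizer μ ubar xbar) (hC : ∀ ω, P.C ω = univ)
    (R : P.RegularTimes ubar xbar δ c k I) (hδ : 0 < δ) (hc : 0 < c)
    (hcont : ∀ w y, P.IsControlledPair w y →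
      (∀ ω, ∀ t ∈ Icc 0 P.T, y t ω ∈ Metric.closedBall (xbar t ω) (δ / 2)) →
      ∀ t ∈ Icc 0 P.T, Continuous (y t))
    (hp : P.IsAdjoint ubar xbar p) (hpc : ∀ t ∈ Icc 0 P.T, Continuous (p t))
    (hgm : Measurable (fun z : Euc n × Ω => P.g z.1 z.2)) (hg : P.SmoothCost xbar δ) {kg : Ω → ℝ}
    (hkgi : Integrable kg μ)
    (hkg : ∀ ω ∈ μ.support, ∀ x ∈ Metric.closedBall (xbar P.T ω) δ,
      ∀ x' ∈ Metric.closedBall (xbar P.T ω) δ, |P.g x ω - P.g x' ω| ≤ kg ω * ‖x - x'‖)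
    {B : Set ℝ} (hB : MeasurableSet B) (hBI : B ⊆ I) (hB0 : volume B ≠ 0) {v : ℝ → Euc m}
    (hv : Measurable v) (hvU : ∀ t ∈ B, v t ∈ P.U t) {η : ℝ} (hη : 0 < η)
    (hH : ∀ t ∈ B, η ≤ P.hamiltonian μ xbar p t (v t) - P.hamiltonian μ xbar p t (ubar t)) :
    False := by
  obtain ⟨⟨hx, -⟩, hcost, ε, hε, hloc⟩ := hmin
  have h0T : (0 : ℝ) ∈ Icc 0 P.T := ⟨le_rfl, P.T_pos.le⟩
  have hTT : P.T ∈ Icc 0 P.T := ⟨P.T_pos.le, le_rfl⟩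
  have hxc := hcont _ _ hx fun ω t _ => Metric.mem_closedBall_self (half_pos hδ).le
  have hsupp : ∀ᵐ ω ∂μ, ω ∈ μ.support := Measure.support_mem_ae
  have hpb : ∀ ω ∈ μ.support, ∀ t ∈ Icc 0 P.T, ‖p t ω‖ ≤ 2 * |kg ω| * expWeight k P.T :=
    fun ω hω t ht => hp.norm_le_of_mem_support R hx hδ hg hkg hω ht
  set W := expWeight k P.T with hW
  have hW0 : 0 < W := expWeight_pos _
  set κ := ∫ s in (0 : ℝ)..P.T, k s with hκ
  have hκ0 : 0 ≤ κ := intervalIntegral.integral_nonneg P.T_pos.le fun s _ => R.nonneg s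
  set K := 4 * c * W with hK
  have hK0 : 0 < K := by positivity
  -- shrinking sets of times
  obtain ⟨τ, hτB, hτ⟩ := exists_mem_forall_mem_nhdsWithin_pos_measure hB0
  -- Since `h j ≤ 2 * r`, the first term keeps the perturbed arcs in the tube of radius `δ / 2`, and
  -- the second keeps them within `ε` in the `W^{1,1}` norm.
  set r := min (δ / (4 * K)) (ε / (2 * (2 * c + K * κ))) with hr
  have hr0 : 0 < r := lt_min (by positivity) (by positivity)
  set A : ℕ → Set ℝ := fun j => B ∩ Metric.closedBall τ (r / (j + 1)) with hAdef
  have hA : ∀ j, MeasurableSet (A j) := fun j => hB.inter measurableSet_closedBall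
  have hAB : ∀ j, A j ⊆ B := fun j => inter_subset_left
  have hAI : ∀ j, A j ⊆ I := fun j => (hAB j).trans hBI
  have hAfin : ∀ j, volume (A j) ≠ ∞ := fun j =>
    ((measure_mono ((hAI j).trans R.subset)).trans_lt (by simp)).ne
  have hAU : ∀ j, ∀ t ∈ A j, v t ∈ P.U t := fun j t ht => hvU t (hAB j ht)
  set h : ℕ → ℝ := fun j => volume.real (A j) with hhdef
  have hh : ∀ j, 0 < h j := fun j => ENNReal.toReal_pos (hτ _ (inter_mem self_mem_nhdsWithin
    (mem_nhdsWithin_of_mem_nhds (Metric.closedBall_mem_nhds _ (by positivity))))).ne' (hAfin j)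
  have hhr : ∀ j, h j ≤ 2 * (r / (j + 1)) := fun j => by
    refine ENNReal.toReal_le_of_le_ofReal (by positivity) ?_
    rw [← Real.volume_closedBall]
    exact measure_mono inter_subset_right
  have hrlim : Tendsto (fun j : ℕ => r / ((j : ℝ) + 1)) atTop (𝓝 0) :=
    tendsto_const_div_atTop_nhds_zero_nat r |>.comp (tendsto_add_atTop_nat 1) |>.congr fun j => by
      simp
  have hh0 : Tendsto h atTop (𝓝 0) := squeeze_zero (fun j => (hh j).le) hhr
    (by simpa using hrlim.const_mul 2)
  have hh2 : ∀ j, h j ≤ 2 * r := fun j => (hhr j).trans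
    (mul_le_mul_of_nonneg_left (div_le_self hr0.le (by simp)) two_pos.le)
  have hKδ : ∀ j, K * h j ≤ δ / 2 := fun j => by
    have h1 : r ≤ δ / (4 * K) := min_le_left _ _
    rw [le_div_iff₀ (by positivity)] at h1
    nlinarith [hh2 j]
  have hKε : ∀ j, 2 * c * h j + K * h j * κ ≤ ε := fun j => by
    have h1 : r ≤ ε / (2 * (2 * c + K * κ)) := min_le_right _ _
    rw [le_div_iff₀ (by positivity)] at h1
    have h2 : 0 ≤ 2 * c + K * κ := by positivity
    nlinarith [hh2 j]
  have hsh : ∀ᵐ t ∂(volume.restrict (Icc 0 P.T)), ∀ᶠ j in atTop, t ∉ A j := by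
    have h1 : ∀ᵐ t : ℝ, t ≠ τ := by simp [ae_iff]
    filter_upwards [ae_restrict_of_ae h1] with t ht
    filter_upwards [hrlim.eventually (gt_mem_nhds (dist_pos.2 ht))] with j hj hmem
    exact absurd hmem.2 (not_le.2 hj)
  clear_value A
  -- the perturbed processes
  choose y hy hyx using fun j => R.exists_isControlledPair_piecewise hx hδ hc (hA j) (hAI j) hv
    (hAU j) (by have := hKδ j; simp only [hK, hhdef] at this; linarith)
  have hyK : ∀ j ω, ∀ t ∈ Icc 0 P.T, ‖y j t ω - xbar t ω‖ ≤ K * h j := fun j ω t ht =>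
    (hyx j ω t ht).trans (le_of_eq (by simp only [hK, hhdef]; ring))
  have hyδ2 : ∀ j ω, ∀ t ∈ Icc 0 P.T, y j t ω ∈ Metric.closedBall (xbar t ω) (δ / 2) :=
    fun j ω t ht => mem_closedBall_iff_norm.2 ((hyK j ω t ht).trans (hKδ j))
  have hyδ : ∀ j ω, ∀ t ∈ Icc 0 P.T, y j t ω ∈ Metric.closedBall (xbar t ω) δ :=
    fun j ω t ht => Metric.closedBall_subset_closedBall (half_le_self hδ.le) (hyδ2 j ω t ht)
  have hxδ : ∀ ω, ∀ t ∈ Icc 0 P.T, xbar t ω ∈ Metric.closedBall (xbar t ω) δ := fun ω t _ =>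
    Metric.mem_closedBall_self hδ.le
  have hgx : Integrable (fun ω => P.g (xbar P.T ω) ω) μ := by
    by_contra hc
    exact hcost (by simp [cost, hc])
  have hgdb : ∀ j, ∀ ω ∈ μ.support, ‖P.g (y j P.T ω) ω - P.g (xbar P.T ω) ω‖
      ≤ |kg ω| * (K * h j) := fun j ω hω => by
    refine (hkg ω hω _ (hyδ j ω _ hTT) _ (hxδ ω _ hTT)).trans ?_
    exact mul_le_mul (le_abs_self _) (hyK j ω _ hTT) (norm_nonneg _) (abs_nonneg _)
  have hgd : ∀ j, Integrable (fun ω => P.g (y j P.T ω) ω - P.g (xbar P.T ω) ω) μ := fun j => by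
    refine (hkgi.abs.mul_const (K * h j)).mono' ?_ (hsupp.mono (hgdb j))
    exact ((hgm.comp ((hcont _ _ (hy j) (hyδ2 j) _ hTT).measurable.prodMk measurable_id)).sub
      (hgm.comp ((hxc _ hTT).measurable.prodMk measurable_id))).aestronglyMeasurable
  have hgy : ∀ j, Integrable (fun ω => P.g (y j P.T ω) ω) μ := fun j => by
    exact ((hgd j).add hgx).congr (Eventually.of_forall fun ω => sub_add_cancel _ _)
  -- The perturbed processes are feasible because there is no end-point constraint, and their costs
  -- are genuine integrals by `hgy`; minimality therefore becomes a real inequality.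
  have hcost_le : ∀ j, 0 ≤ ∫ ω, (P.g (y j P.T ω) ω - P.g (xbar P.T ω) ω) ∂μ := fun j => by
    have h1 := hloc _ (y j) ⟨hy j, by simp [hC, Metric.infEDist_zero_of_mem]⟩ fun ω _ =>
      (R.normW11_sub_le hx hδ hc (hA j) (hAI j) (hAU j) (hy j) ((hKδ j).trans
        (half_le_self hδ.le)) (hyK j ω)).trans (hKε j)
    rw [cost, cost, if_pos hgx, if_pos (hgy j), EReal.coe_le_coe_iff] at h1
    rw [integral_sub (hgy j) hgx]
    linarith
  -- the variation of the Hamiltonian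
  set Φ : Ω → ℝ → ℝ := fun ω s => inner ℝ (p s ω) (P.f s (xbar s ω) (v s) ω)
    - inner ℝ (p s ω) (P.f s (xbar s ω) (ubar s) ω) with hΦ
  have hΦb : ∀ ω ∈ μ.support, ∀ s ∈ B, ‖Φ ω s‖ ≤ 2 * |kg ω| * W * (2 * c) := fun ω hω s hs => by
    have hsT := R.subset (hBI hs)
    rw [hΦ]
    simp only
    rw [← inner_sub_right]
    have h1 := hpb ω hω s hsT
    refine (norm_inner_le_norm _ _).trans (mul_le_mul h1 ?_ (norm_nonneg _)
      ((norm_nonneg _).trans h1))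
    have h2 := R.bound s (hBI hs) ω _ (hvU s hs) _ (hxδ ω s hsT)
    have h3 := R.bound s (hBI hs) ω _ (R.ubar_mem s (hBI hs)) _ (hxδ ω s hsT)
    exact (norm_sub_le _ _).trans (by linarith)
  have hΦi : ∀ j, Integrable (Function.uncurry Φ) (μ.prod (volume.restrict (A j))) := fun j => by
    have : IsFiniteMeasure (volume.restrict (A j)) := ⟨by
      simpa using (hAfin j).lt_top⟩
    have hAe : ∀ᵐ z ∂(μ.prod (volume.restrict (A j))), z.2 ∈ A j :=
      Measure.quasiMeasurePreserving_snd.ae (ae_restrict_mem (hA j))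
    have hSe : ∀ᵐ z ∂(μ.prod (volume.restrict (A j))), z.1 ∈ μ.support :=
      Measure.quasiMeasurePreserving_fst.ae hsupp
    refine Integrable.mono' (g := fun z : Ω × ℝ => 2 * |kg z.1| * W * (2 * c))
      ((((hkgi.abs.const_mul 2).mul_const W).mul_const (2 * c)).comp_fst _) ?_ ?_
    · have hms : MeasurableSet {z : Ω × ℝ | z.2 ∈ A j} := measurable_snd (hA j)
      refine (measurable_indicator_of_restrict hms (G := Function.uncurry Φ)
        ?_).aestronglyMeasurable.congr (hAe.mono fun z hz => indicator_of_mem hz _)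
      have hm2 : Measurable fun z : {z : Ω × ℝ | z.2 ∈ A j} => z.1.2 :=
        measurable_snd.comp measurable_subtype_coe
      have hm1 : Measurable fun z : {z : Ω × ℝ | z.2 ∈ A j} => z.1.1 :=
        measurable_fst.comp measurable_subtype_coe
      exact (R.measurable_inner hx hδ hxc hp.continuousOn hpc hm2 (hv.comp hm2) hm1
        (fun z => hAI j z.2) fun z => hAU j _ z.2).sub
        (R.measurable_inner hx hδ hxc hp.continuousOn hpc hm2 (R.measurable_ubar_coe.comp
        (hm2.subtype_mk (h := fun z => hAI j z.2))) hm1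
        (fun z => hAI j z.2) fun z => R.ubar_mem _ (hAI j z.2))
    · filter_upwards [hAe, hSe] with z h1 h2
      exact hΦb z.1 h2 z.2 (hAB j h1)
  have hΨ : ∀ j ω, ∫ s in Icc 0 P.T, inner ℝ (p s ω)
      (P.f s (xbar s ω) ((A j).piecewise v ubar s) ω - P.f s (xbar s ω) (ubar s) ω)
      = ∫ s in A j, Φ ω s := fun j ω => by
    have h1 : (fun s => inner ℝ (p s ω) (P.f s (xbar s ω) ((A j).piecewise v ubar s) ω
        - P.f s (xbar s ω) (ubar s) ω)) = (A j).indicator (Φ ω) := by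
      ext s
      by_cases hs : s ∈ A j
      · simp [hs, hΦ, inner_sub_right]
      · simp [hs]
    rw [h1, setIntegral_indicator (hA j), inter_eq_right.2 ((hAI j).trans R.subset)]
  have hham : ∀ j, η * h j ≤ ∫ ω, (∫ s in A j, Φ ω s) ∂μ := fun j => by
    rw [integral_integral_swap (hΦi j)]
    have h1 : ∫ _ in A j, η = η * h j := by
      rw [setIntegral_const, smul_eq_mul, mul_comm]
    rw [← h1]
    refine setIntegral_mono_on (integrableOn_const (hAfin j)) (hΦi j).integral_prod_right (hA j)
      fun s hs => ?_
    have h2 := R.integrable_inner hx hδ hxc hp hpc hkgi hpb (hAI j hs) (hAU j s hs)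
    have h3 := R.integrable_inner hx hδ hxc hp hpc hkgi hpb (hAI j hs)
      (R.ubar_mem s (hAI j hs))
    simp only [hΦ]
    rw [integral_sub h2 h3]
    exact hH s (hAB j hs)
  -- passage to the limit
  set Q : ℕ → Ω → ℝ := fun j ω => (h j)⁻¹ * (P.g (y j P.T ω) ω - P.g (xbar P.T ω) ω)
    + (h j)⁻¹ * ∫ s in A j, Φ ω s with hQ
  have hQi : ∀ j, Integrable (Q j) μ := fun j =>
    ((hgd j).const_mul _).add ((hΦi j).integral_prod_left.const_mul _)
  have hQlim : Tendsto (fun j => ∫ ω, Q j ω ∂μ) atTop (𝓝 0) := by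
    rw [show 𝓝 (0 : ℝ) = 𝓝 (∫ _, (0 : ℝ) ∂μ) by simp]
    refine tendsto_integral_of_dominated_convergence
      (fun ω => |kg ω| * K + 2 * |kg ω| * W * (2 * c)) (fun j => (hQi j).aestronglyMeasurable)
      ((hkgi.abs.mul_const K).add (((hkgi.abs.const_mul 2).mul_const W).mul_const (2 * c)))
      (fun j => ?_) (Eventually.of_forall fun ω => ?_)
    · filter_upwards [hsupp] with ω hω
      refine (norm_add_le _ _).trans (add_le_add ?_ ?_)
      · rw [norm_mul, norm_inv, Real.norm_of_nonneg (hh j).le, inv_mul_le_iff₀ (hh j)]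
        exact (hgdb j ω hω).trans (le_of_eq (by ring))
      · rw [norm_mul, norm_inv, Real.norm_of_nonneg (hh j).le, inv_mul_le_iff₀ (hh j), mul_comm (h j)]
        exact norm_setIntegral_le_of_norm_le_const (hAfin j).lt_top
          fun s hs => hΦb ω hω s (hAB j hs)
    · have := hp.tendsto_cost_quotient R hx hδ hA hv hAU hy ω (fun j => hyδ j ω) hh hh0
        (fun j => hyK j ω) hsh (hg.1 ω _ (hxδ ω _ hTT))
      refine this.congr fun j => ?_
      rw [hΨ]
  refine absurd (ge_of_tendsto hQlim (Eventually.of_forall fun j => ?_)) (not_le.2 hη)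
  have hΨi : Integrable (fun ω => ∫ s in A j, Φ ω s) μ := (hΦi j).integral_prod_left
  rw [integral_add ((hgd j).const_mul _) (hΨi.const_mul _), integral_const_mul, integral_const_mul]
  have h1 : 0 ≤ (h j)⁻¹ * ∫ ω, (P.g (y j P.T ω) ω - P.g (xbar P.T ω) ω) ∂μ :=
    mul_nonneg (inv_nonneg.2 (hh j).le) (hcost_le j)
  have h2 : η ≤ (h j)⁻¹ * ∫ ω, (∫ s in A j, Φ ω s) ∂μ := by
    rw [le_inv_mul_iff₀ (hh j), mul_comm]
    exact hham j
  linarith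

end AverageProblem

/-! ### The maximum principle. -/

theorem theorem3p3 {n m : ℕ} {Ω : Type*} [MetricSpace Ω] [CompleteSpace Ω]
    [TopologicalSpace.SeparableSpace Ω] [MeasurableSpace Ω] [BorelSpace Ω]
    (μ : Measure Ω) [IsProbabilityMeasure μ]
    (P : AverageProblem n m Ω) (ubar : ℝ → Euc m) (xbar : ℝ → Ω → Euc n)
    (hmin : P.IsLocalMinimizer μ ubar xbar)
    (δ : ℝ) (hδ : 0 < δ)
    (hmeas : P.MeasurableData xbar δ)
    (hdyn : P.LipschitzBoundedDynamics xbar δ)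
    (hg_meas : Measurable (fun z : Euc n × Ω => P.g z.1 z.2))
    (hparam : P.ParameterModulus xbar δ)
    (hg_smooth : P.SmoothCost xbar δ)
    (hg_lip : P.LipschitzCost μ xbar δ)
    (hf_smooth : P.SmoothDynamics xbar δ)
    (hC : ∀ ω, P.C ω = univ) :
    ∃ p : ℝ → Ω → Euc n,
      Measurable (fun z : LebInterval P.T × Ω => p z.1.val z.2) ∧
      (∀ ω ∈ μ.support, IsW11 P.T (fun t => p t ω)) ∧
      (∀ᵐ t ∂(volume.restrict (Icc 0 P.T)),
        (∀ u ∈ P.U t, Integrable (fun ω => inner ℝ (p t ω) (P.f t (xbar t ω) u ω)) μ) ∧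
        ubar t ∈ P.U t ∧
        IsMaxOn (fun u => ∫ ω, inner ℝ (p t ω) (P.f t (xbar t ω) u ω) ∂μ) (P.U t) (ubar t)) ∧
      (∀ ω ∈ μ.support, ∀ᵐ t ∂(volume.restrict (Icc 0 P.T)),
        HasDerivAt (fun s => p s ω)
          (-(ContinuousLinearMap.adjoint (P.gradF t (xbar t ω) (ubar t) ω) (p t ω))) t) ∧
      (∀ ω ∈ μ.support,
        -(p P.T ω) = gradient (fun y => P.g y ω) (xbar P.T ω)) := by
  have : SecondCountableTopology Ω := UniformSpace.secondCountable_of_separable Ω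
  have hx := hmin.1.1
  obtain ⟨c, hc, k, I, R⟩ := AverageProblem.exists_regularTimes hx.1 hmeas hdyn hf_smooth
  obtain ⟨kg, hkgi, hkg⟩ := hg_lip
  have hcont : ∀ w y, P.IsControlledPair w y →
      (∀ ω, ∀ t ∈ Icc 0 P.T, y t ω ∈ Metric.closedBall (xbar t ω) (δ / 2)) →
      ∀ t ∈ Icc 0 P.T, Continuous (y t) := fun w y hy hyδ t ht =>
    hy.continuous R hparam hyδ hδ ht
  have hxc := hcont _ _ hx fun ω t _ => Metric.mem_closedBall_self (half_pos hδ).le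
  obtain ⟨p, hp⟩ := R.exists_isAdjoint hx hδ
  have hpc : ∀ t ∈ Icc 0 P.T, Continuous (p t) := fun t ht =>
    hp.continuous R hx hδ hf_smooth hg_smooth hxc ht
  refine ⟨p, measurable_comp_of_continuous hp.continuousOn hpc
    (measurable_lebInterval_val.comp measurable_fst) measurable_snd
    (fun z => Subtype.property (p := fun s => s ∈ Icc (0 : ℝ) P.T) z.1),
    fun ω _ => (hp.isW11 R hx hδ ω).1, ?_, fun ω _ => (hp.isW11 R hx hδ ω).2,
    fun ω _ => by rw [hp.apply_end, neg_neg]⟩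
  -- Margins `1 / (i + 1)` exhaust all strict improvements. There are countably many, so a single
  -- null set of times excludes them all, simultaneously for every `u ∈ U t`.
  have hnull : ∀ i : ℕ, (volume.restrict (Icc 0 P.T)) (Prod.fst '' {z : ℝ × Euc m |
      (z.1 ∈ I ∧ z.2 ∈ P.U z.1) ∧ 1 / ((i : ℝ) + 1) ≤
        P.hamiltonian μ xbar p z.1 z.2 - P.hamiltonian μ xbar p z.1 (ubar z.1)}) = 0 := fun i => by
    by_contra hne
    obtain ⟨B, v, hB, hB0, hv, hBv⟩ := exists_measurable_selection _
      (R.measurableSet_improving hx hδ hxc hp.continuousOn hpc (1 / ((i : ℝ) + 1))) hne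
    exact hmin.not_improvable hC R hδ hc hcont hp hpc hg_meas hg_smooth hkgi hkg hB
      (fun t ht => (hBv t ht).1.1) (fun h => hB0 (nonpos_iff_eq_zero.1
        ((Measure.restrict_apply_le _ _).trans h.le))) hv
      (fun t ht => (hBv t ht).1.2) (by positivity) fun t ht => (hBv t ht).2
  filter_upwards [R.ae_mem, ae_all_iff.2 fun i => measure_eq_zero_iff_ae_notMem.1 (hnull i)]
    with t ht hti
  refine ⟨fun u hu => R.integrable_inner hx hδ hxc hp hpc hkgi
    (fun ω hω t ht => hp.norm_le_of_mem_support R hx hδ hg_smooth hkg hω ht) ht hu,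
    R.ubar_mem t ht, fun u hu => ?_⟩
  by_contra hlt
  have hlt' : P.hamiltonian μ xbar p t (ubar t) < P.hamiltonian μ xbar p t u := not_le.1 hlt
  obtain ⟨i, hi⟩ := exists_nat_one_div_lt (sub_pos.2 hlt')
  exact hti i ⟨(t, u), ⟨⟨ht, hu⟩, hi.le⟩, rfl⟩
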